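/- Let $M=\mathbb R^3$, or $M=S^3=\mathbb R^3\cup\{\infty\}$, the unit sphere of $\mathbb R^4$, where $\mathbb R^3$ is included by the inverse $\sigma$ of the stereographic projection from $(0,0,0,1)$ onto the equatorial hyperplane, i.e. $\sigma(p)=\frac{(2p,\,|p|^2-1)}{|p|^2+1}$, and $S^3$ has the orientation extending the standard one of $\mathbb R^3$. Let $u\colon M\to M$ be the involution $(x,y,z)\mapsto(x,-y,-z)$ of $\mathbb R^3$, respectively its extension $(x_0,x_1,x_2,x_3)\mapsto(x_0,-x_1,-x_2,x_3)$ to $S^3$. An invariant contact structure on $M$ is a plane field $\xi=\ker\alpha$, where $\alpha$ is a smooth $1$-form on $M$ with $\alpha\wedge d\alpha>0$ everywhere, such that $u^*\xi=\xi$ and $u^*\alpha=-\alpha$. Proposition 2.5 (EDarbouxustd). For every invariant contact structure $\xi$ on $M$ there is a smooth isotopy $(\psi_t)_{t\in[0,1]}$ of $M$ by diffeomorphisms of $M$, with $\psi_0=\mathrm{id}$ and $\psi_t\circ u=u\circ\psi_t$ for all $t\in[0,1]$, such that $T\psi_1(\xi)$ coincides with $\ker(dz-y\,dx)$ in a neighborhood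 of the origin of $\mathbb R^3$ (in the case of $S^3$: $\sigma^*(T\psi_1(\xi))=\ker(dz-y\,dx)$ in a neighborhood of the origin of $\mathbb R^3$). -/

import Mathlib

open scoped Manifold ContDiff Topology

/-- Euclidean 3-space; the coordinates `x`, `y`, `z` are those with index `0`, `1`, `2`. -/
abbrev R3 : Type := EuclideanSpace ℝ (Fin 3)

/-- The unit sphere `S³ ⊆ ℝ⁴`, with Mathlib's smooth structure. -/
abbrev S3 : Type := Metric.sphere (0 : EuclideanSpace ℝ (Fin 4)) 1

/-- Differential 1-forms (no smoothness assumed) on a 3-manifold. -/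
abbrev OneForm (M : Type*) [TopologicalSpace M] [ChartedSpace R3 M] : Type _ :=
  (p : M) → TangentSpace (𝓡 3) p →L[ℝ] ℝ

/-- Fields of tangent subspaces on a 3-manifold. -/
abbrev TangentField (M : Type*) [TopologicalSpace M] [ChartedSpace R3 M] : Type _ :=
  (p : M) → Submodule ℝ (TangentSpace (𝓡 3) p)

section General

variable {M N : Type*} [TopologicalSpace M] [ChartedSpace R3 M]
  [TopologicalSpace N] [ChartedSpace R3 N]

/-- The pull-back `f^*α` of a 1-form. -/
noncomputable def OneForm.pullback (f : M → N) (α : OneForm N) : OneForm M :=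
  fun p => (α (f p)).comp (mfderiv (𝓡 3) (𝓡 3) f p)

/-- The pull-back `f^*ξ`: a vector `v` at `p` belongs to `f^*ξ` iff `df_p v ∈ ξ_{f p}`. -/
noncomputable def TangentField.pullback (f : M → N) (ξ : TangentField N) : TangentField M :=
  fun p => (ξ (f p)).comap (mfderiv (𝓡 3) (𝓡 3) f p).toLinearMap

/-- The image `Tφ(ξ)` of `ξ` under a diffeomorphism `φ`, i.e. the pull-back of `ξ` by `φ⁻¹`. -/
noncomputable def TangentField.pushforward (φ : M ≃ₘ^∞⟮𝓡 3, 𝓡 3⟯ N) (ξ : TangentField M) :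
    TangentField N :=
  TangentField.pullback φ.symm ξ

/-- The kernel of a 1-form. -/
noncomputable def OneForm.ker (α : OneForm M) : TangentField M := fun p => LinearMap.ker (α p).toLinearMap

end General

/-- The exterior derivative of a 1-form on `ℝ³`:
`da(v, w) = ∂_v (a(w)) - ∂_w (a(v))` for constant `v`, `w`. -/
noncomputable def extDerivOne (a : R3 → R3 →L[ℝ] ℝ) (p v w : R3) : ℝ :=
  fderiv ℝ a p v w - fderiv ℝ a p w v

/-- The coefficient of `a ∧ da` with respect to `dx ∧ dy ∧ dz`, i.e. the value of `a ∧ da` on the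
standard basis of `ℝ³`. -/
noncomputable def wedgeExtDeriv (a : R3 → R3 →L[ℝ] ℝ) (p : R3) : ℝ :=
  let e : Fin 3 → R3 := fun i => EuclideanSpace.single i 1
  a p (e 0) * extDerivOne a p (e 1) (e 2) + a p (e 1) * extDerivOne a p (e 2) (e 0)
    + a p (e 2) * extDerivOne a p (e 0) (e 1)

/-- `a` is a smooth 1-form on `ℝ³` such that `a ∧ da` is everywhere positive with respect to the
standard orientation. -/
def IsPositiveContactR3 (a : R3 → R3 →L[ℝ] ℝ) : Prop :=
  ContDiff ℝ ∞ a ∧ ∀ p, 0 < wedgeExtDeriv a p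

section Contact

variable {M : Type*} [TopologicalSpace M] [ChartedSpace R3 M]

/-- Positive contact forms on a 3-manifold `M`, whose smooth structure and orientation are given by
a set `P` of parametrizations `ℝ³ → M` whose images cover `M` (the inverses of the charts of an
oriented atlas): in each of them the form is smooth and `α ∧ dα` is positive. -/
def IsPositiveContactForm (P : Set (R3 → M)) (α : OneForm M) : Prop :=
  ∀ φ ∈ P, IsPositiveContactR3 (OneForm.pullback φ α)

/-- `ξ` is a positively cooriented contact structure `ker α` which is invariant under `u`,
in the sense that `u^*ξ = ξ` and `u^*α = -α`. -/
def IsInvariantContactStructure (P : Set (R3 → M)) (u : M → M) (ξ : TangentField M) : Prop :=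
  TangentField.pullback u ξ = ξ ∧
    ∃ α : OneForm M, IsPositiveContactForm P α ∧ ξ = OneForm.ker α ∧
      ∀ p, OneForm.pullback u α p = -α p

/-- `(ψ_t)`, `t ∈ [0, 1]`, is a smooth isotopy of the whole of `M`, starting at the identity, by
diffeomorphisms that commute with `u`. (The values for `t ∉ [0, 1]` are irrelevant.) -/
structure IsEquivariantIsotopy (u : M → M) (ψ : ℝ → M ≃ₘ^∞⟮𝓡 3, 𝓡 3⟯ M) : Prop where
  smooth : ContMDiffOn (𝓘(ℝ, ℝ).prod (𝓡 3)) (𝓡 3) ∞ (fun q : ℝ × M => ψ q.1 q.2)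
    (Set.Icc (0 : ℝ) 1 ×ˢ Set.univ)
  zero : ∀ p, ψ 0 p = p
  equivariant : ∀ t ∈ Set.Icc (0 : ℝ) 1, ∀ p, ψ t (u p) = u (ψ t p)

end Contact

/-- The 1-form `dz - y dx` on `ℝ³`. -/
noncomputable def stdForm : OneForm R3 :=
  fun p => (EuclideanSpace.proj 2 - p 1 • EuclideanSpace.proj 0 : R3 →L[ℝ] ℝ)

/-- The involution `(x, y, z) ↦ (x, -y, -z)` of `ℝ³`. -/
noncomputable def rotR3 (p : R3) : R3 := !₂[p 0, -p 1, -p 2]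

/-- The oriented atlas of `ℝ³`. -/
def atlasR3 : Set (R3 → R3) := {id}

theorem mem_S3_iff (p : EuclideanSpace ℝ (Fin 4)) :
    p ∈ Metric.sphere (0 : EuclideanSpace ℝ (Fin 4)) 1 ↔
      p 0 ^ 2 + p 1 ^ 2 + p 2 ^ 2 + p 3 ^ 2 = 1 := by
  rw [mem_sphere_zero_iff_norm, EuclideanSpace.norm_eq, Real.sqrt_eq_one]
  simp [Fin.sum_univ_four]

/-- The extension `(x₀, x₁, x₂, x₃) ↦ (x₀, -x₁, -x₂, x₃)` of `rotR3` to `S³ = ℝ³ ∪ {∞}`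
(the identification is by stereographic projection from `∞ = (0, 0, 0, 1)`). -/
noncomputable def rotS3 (p : S3) : S3 :=
  ⟨!₂[p.1 0, -p.1 1, -p.1 2, p.1 3], by
    have h := (mem_S3_iff p.1).1 p.2
    rw [mem_S3_iff]
    simpa using h⟩

/-- The inclusion `ℝ³ → S³ = ℝ³ ∪ {∞}`, i.e. the inverse of the stereographic projection from
`∞ = (0, 0, 0, 1)` to the equatorial hyperplane; the origin is sent to `(0, 0, 0, -1)`. -/
noncomputable def stereoInv (p : R3) : S3 :=
  ⟨!₂[2 * p 0 / (p 0 ^ 2 + p 1 ^ 2 + p 2 ^ 2 + 1), 2 * p 1 / (p 0 ^ 2 + p 1 ^ 2 + p 2 ^ 2 + 1),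
      2 * p 2 / (p 0 ^ 2 + p 1 ^ 2 + p 2 ^ 2 + 1),
      (p 0 ^ 2 + p 1 ^ 2 + p 2 ^ 2 - 1) / (p 0 ^ 2 + p 1 ^ 2 + p 2 ^ 2 + 1)], by
    have h : p 0 ^ 2 + p 1 ^ 2 + p 2 ^ 2 + 1 ≠ 0 := by positivity
    rw [mem_S3_iff]
    simp
    field_simp
    ring⟩

/-- The inverse of the stereographic projection from `(0, 0, 0, -1)`, precomposed with
`(x, y, z) ↦ (-x, y, z)` in order to induce the same orientation of `S³` as `stereoInv`. -/
noncomputable def stereoInv' (p : R3) : S3 :=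
  ⟨!₂[-(2 * p 0) / (p 0 ^ 2 + p 1 ^ 2 + p 2 ^ 2 + 1), 2 * p 1 / (p 0 ^ 2 + p 1 ^ 2 + p 2 ^ 2 + 1),
      2 * p 2 / (p 0 ^ 2 + p 1 ^ 2 + p 2 ^ 2 + 1),
      (1 - (p 0 ^ 2 + p 1 ^ 2 + p 2 ^ 2)) / (p 0 ^ 2 + p 1 ^ 2 + p 2 ^ 2 + 1)], by
    have h : p 0 ^ 2 + p 1 ^ 2 + p 2 ^ 2 + 1 ≠ 0 := by positivity
    rw [mem_S3_iff]
    simp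
    field_simp
    ring⟩

/-- The oriented atlas of `S³ = ℝ³ ∪ {∞}`; its orientation extends that of `ℝ³`. -/
def atlasS3 : Set (R3 → S3) := {stereoInv, stereoInv'}

/-! Write the contact form near the origin as `A dx + B dy + C dz`. Anti-invariance under the
involution makes `A` odd and `B`, `C` even, so the form at the origin is `B dy + C dz`.
Multiplication by a nonzero complex number in the `yz`-plane commutes with the involution, and a
suitable one turns this covector into `dz` (`exists_darboux`).

In the normalized case (`exists_darboux_of_normalized`), let `g` be an odd solution of `∂g/∂y =
(B/C) ∂g/∂z` with `∂g/∂z = 1` at the origin. Near the origin, `dg` minus `(∂g/∂z)/C` times the form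
has neither a `dy` nor a `dz` component, hence equals `f dx`. Therefore `φ = (x, f, g)` pulls `dz -
y dx` back to a nonzero multiple of the form. Since `f` and `g` are odd, `φ` is equivariant; its
derivative at the origin is a shear in `y` and `z` whose diagonal entry `∂f/∂y` is the value of `a ∧
da` there, hence positive.

It remains to realize the germ of `φ` by an equivariant isotopy of compact support (`IsRealizable`).
If `dφ` at the origin is close to the identity, cut off `φ - id` and use the straight-line isotopy
(`exists_pos_forall_isRealizable`). Linear maps joined to the identity by a path of invertible
equivariant ones are products of maps close to the identity (`isRealizable_of_path`), and realizable
germs fixing the origin compose. Compact support lets the isotopy extend to the sphere by fixing `∞`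
(`contMDiffOn_sphereExtend`).

The function `g` comes from characteristics (`exists_local_first_integral`): the characteristic
equation is an integral equation in a space of continuous functions, and the inverse function
theorem there gives smooth dependence on the end point. This rests on the smoothness of
superposition operators. -/

/-! ### Superposition operators on spaces of continuous functions -/

section Superposition

variable {X : Type} [TopologicalSpace X] [CompactSpace X]
  {E F : Type} [NormedAddCommGroup E] [NormedSpace ℝ E] [NormedAddCommGroup F] [NormedSpace ℝ F]

/-- Pointwise application of a continuous family of linear maps to a continuous map, as a
continuous bilinear map. -/
noncomputable def pointwiseApply :
    C(X, E →L[ℝ] F) →L[ℝ] C(X, E) →L[ℝ] C(X, F) :=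
  LinearMap.mkContinuous₂
    (LinearMap.mk₂ ℝ
      (fun (A : C(X, E →L[ℝ] F)) (v : C(X, E)) =>
        (⟨fun x => A x (v x), A.continuous.clm_apply v.continuous⟩ : C(X, F)))
      (fun A B v => by ext; simp) (fun c A v => by ext; simp)
      (fun A v w => by ext; simp) (fun c A v => by ext; simp)) 1
    (fun A v => by
      rw [one_mul, ContinuousMap.norm_le _ (by positivity)]
      intro x
      exact ((A x).le_opNorm (v x)).trans
        (mul_le_mul (A.norm_coe_le_norm x) (v.norm_coe_le_norm x) (norm_nonneg _)
          (by positivity)))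

/-- The superposition operator `w ↦ f ∘ w` is differentiable if `f` is continuously
differentiable. -/
theorem hasFDerivAt_superposition {f : E → F} (hf : ContDiff ℝ 1 f) (w : C(X, E)) :
    HasFDerivAt (fun w : C(X, E) => (ContinuousMap.mk f hf.continuous).comp w)
      (pointwiseApply ((ContinuousMap.mk (fderiv ℝ f) (hf.continuous_fderiv one_ne_zero)).comp w))
      w := by
  set N := fun w : C(X, E) =>
    (ContinuousMap.mk (fderiv ℝ f) (hf.continuous_fderiv one_ne_zero)).comp w with hN
  have hNc : Continuous N := ContinuousMap.continuous_postcomp _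
  rw [hasFDerivAt_iff_isLittleO_nhds_zero, Asymptotics.isLittleO_iff]
  intro ε hε
  obtain ⟨δ, hδ, hδN⟩ := (Metric.continuous_iff (α := C(X, E)) (β := C(X, E →L[ℝ] F))).1 hNc w ε hε
  filter_upwards [Metric.ball_mem_nhds (0 : C(X, E)) hδ] with h hh
  rw [ContinuousMap.norm_le _ (by positivity)]
  intro x
  -- A point of the segment is the value at `x` of `w + t • h`, so continuity of `N` in the sup norm
  -- bounds the variation of the derivative uniformly in `x`.
  have hseg : ∀ y ∈ segment ℝ (w x) (w x + h x), ‖fderiv ℝ f y - fderiv ℝ f (w x)‖ ≤ ε := by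
    intro y hy
    rw [segment_eq_image'] at hy
    obtain ⟨t, ht, rfl⟩ := hy
    have h1 : dist (w + t • h) w < δ := by
      rw [dist_eq_norm, add_sub_cancel_left, norm_smul, Real.norm_of_nonneg ht.1]
      rw [mem_ball_zero_iff] at hh
      nlinarith [ht.2, norm_nonneg h]
    have h2 := (hδN _ h1).le
    have h3 := (ContinuousMap.dist_apply_le_dist (f := N (w + t • h)) (g := N w) x).trans h2
    rw [dist_eq_norm] at h3
    simpa [hN] using h3
  have key := (convex_segment (𝕜 := ℝ) (w x) (w x + h x)).norm_image_sub_le_of_norm_fderiv_le'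
    (fun y _ => (hf.differentiable one_ne_zero) y) hseg
    (left_mem_segment ℝ _ _) (right_mem_segment ℝ _ _)
  rw [add_sub_cancel_left] at key
  exact key.trans (mul_le_mul_of_nonneg_left (h.norm_coe_le_norm x) hε.le)

/-- The derivative is itself a superposition operator, that of `fderiv ℝ f`, followed by a
continuous linear map. Its target is `E →L[ℝ] F`, so the induction has to range over all `F`. -/
theorem contDiff_nat_superposition (n : ℕ) : ∀ {F : Type} [NormedAddCommGroup F] [NormedSpace ℝ F]
    (f : C(E, F)), ContDiff ℝ n f → ContDiff ℝ n (fun w : C(X, E) => f.comp w) := by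
  induction n with
  | zero =>
    intro F _ _ f _
    exact contDiff_zero.2 (ContinuousMap.continuous_postcomp f)
  | succ n ih =>
    intro F _ _ f hf
    have hf1 : ContDiff ℝ 1 f := hf.of_le (by exact_mod_cast Nat.le_add_left 1 n)
    push_cast at hf ⊢
    rw [contDiff_succ_iff_hasFDerivAt]
    refine ⟨_, pointwiseApply.contDiff.comp (ih
      (ContinuousMap.mk (fderiv ℝ f) (hf1.continuous_fderiv one_ne_zero)) ?_),
      hasFDerivAt_superposition hf1⟩
    exact hf.fderiv_right le_rfl

/-- The superposition operator of a smooth map is smooth. -/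
theorem contDiff_superposition (f : C(E, F)) (hf : ContDiff ℝ ∞ f) :
    ContDiff ℝ ∞ (fun w : C(X, E) => f.comp w) :=
  contDiff_infty.2 fun n => contDiff_nat_superposition n f (contDiff_infty.1 hf n)

end Superposition

/-! ### Inverse function theorem -/

/-- The inverse function theorem for smooth maps, with an inverse that is smooth on a whole
neighbourhood. -/
theorem exists_openPartialHomeomorph_smooth_symm {V W : Type*} [NormedAddCommGroup V]
    [NormedSpace ℝ V] [CompleteSpace V] [NormedAddCommGroup W] [NormedSpace ℝ W] {G : V → W}
    (hG : ContDiff ℝ ∞ G) {a : V} (A : V ≃L[ℝ] W) (hA : HasFDerivAt G (A : V →L[ℝ] W) a) :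
    ∃ e : OpenPartialHomeomorph V W, ⇑e = G ∧ a ∈ e.source ∧
      ∀ᶠ w in 𝓝 (G a), ContDiffAt ℝ ∞ e.symm w := by
  have hn : (∞ : WithTop ℕ∞) ≠ 0 := by simp
  refine ⟨hG.contDiffAt.toOpenPartialHomeomorph G hA hn, rfl,
    hG.contDiffAt.mem_toOpenPartialHomeomorph_source hA hn, ?_⟩
  set e := hG.contDiffAt.toOpenPartialHomeomorph G hA hn with he
  have ha : a ∈ e.source := hG.contDiffAt.mem_toOpenPartialHomeomorph_source hA hn
  have hGa : G a ∈ e.target := hG.contDiffAt.image_mem_toOpenPartialHomeomorph_target hA hn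
  have hsymm : e.symm (G a) = a := e.left_inv ha
  -- Invertible operators form an open set, so the derivative stays invertible near `a`; this gives
  -- smoothness of the inverse at nearby points too.
  have h1 : ∀ᶠ v in 𝓝 a, fderiv ℝ G v ∈
      Set.range ((↑) : (V ≃L[ℝ] W) → V →L[ℝ] W) := by
    have := (hG.continuous_fderiv hn).continuousAt (x := a)
    rw [ContinuousAt, hA.fderiv] at this
    exact this (ContinuousLinearEquiv.nhds A)
  have h2 : Filter.Tendsto e.symm (𝓝 (G a)) (𝓝 a) := by
    have := e.continuousAt_symm hGa
    rwa [ContinuousAt, hsymm] at this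
  filter_upwards [h2.eventually h1, e.open_target.mem_nhds hGa] with w ⟨B, hB⟩ hw
  refine e.contDiffAt_symm (f₀' := B) hw ?_ hG.contDiffAt
  rw [hB]
  exact (hG.differentiable hn _).hasFDerivAt

/-! ### Characteristics as an integral equation, and the local first integral -/

section Volterra

/-- The Volterra operator `v ↦ (r ↦ ∫_r^1 v)` on continuous functions on `[0, 1]`. -/
noncomputable def volterra : C(unitInterval, ℝ) →L[ℝ] C(unitInterval, ℝ) :=
  LinearMap.mkContinuous
    { toFun := fun v =>
        ⟨fun r => ∫ s in (r : ℝ)..1, Set.IccExtend zero_le_one v s, by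
          have hc : Continuous (Set.IccExtend (zero_le_one' ℝ) v) := v.continuous.Icc_extend'
          have h : Continuous fun r : ℝ => ∫ s in r..1, Set.IccExtend (zero_le_one' ℝ) v s := by
            simp_rw [intervalIntegral.integral_symm 1]
            exact (intervalIntegral.continuous_primitive
              (fun a b => hc.intervalIntegrable a b) 1).neg
          exact h.comp continuous_subtype_val⟩
      map_add' := fun v w => by
        ext r
        have hv : Continuous (Set.IccExtend (zero_le_one' ℝ) v) := v.continuous.Icc_extend'
        have hw : Continuous (Set.IccExtend (zero_le_one' ℝ) w) := w.continuous.Icc_extend'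
        exact intervalIntegral.integral_add (hv.intervalIntegrable _ _)
          (hw.intervalIntegrable _ _)
      map_smul' := fun c v => by
        ext r
        exact intervalIntegral.integral_smul c _ }
    1 (fun v => by
      rw [one_mul, ContinuousMap.norm_le _ (norm_nonneg _)]
      intro r
      have := intervalIntegral.norm_integral_le_of_norm_le_const (a := (r : ℝ)) (b := 1)
        (C := ‖v‖) (f := Set.IccExtend (zero_le_one' ℝ) v) (fun x _ => v.norm_coe_le_norm _)
      refine this.trans (mul_le_of_le_one_right (norm_nonneg _) ?_)
      rw [abs_of_nonneg (by linarith [r.2.2])]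
      linarith [r.2.1])

theorem volterra_apply (v : C(unitInterval, ℝ)) (r : unitInterval) :
    volterra v r = ∫ s in (r : ℝ)..1, Set.IccExtend (zero_le_one' ℝ) v s := rfl

end Volterra

section FirstIntegral

/-- The graph `s ↦ (x, y s, ζ(s))` of a rescaled curve. -/
noncomputable def curveGraph (q : R3 × C(unitInterval, ℝ)) : C(unitInterval, R3) :=
  ContinuousLinearMap.compLeftContinuous ℝ unitInterval
      (ContinuousLinearMap.toSpanSingleton ℝ (EuclideanSpace.single 2 1 : R3)) q.2
    + (EuclideanSpace.proj 0 : R3 →L[ℝ] ℝ) q.1 •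
      ContinuousMap.const unitInterval (EuclideanSpace.single 0 1 : R3)
    + (EuclideanSpace.proj 1 : R3 →L[ℝ] ℝ) q.1 •
      (⟨fun s => (s : ℝ) • EuclideanSpace.single 1 1, by fun_prop⟩ : C(unitInterval, R3))

theorem curveGraph_apply (q : R3 × C(unitInterval, ℝ)) (s : unitInterval) :
    curveGraph q s = !₂[q.1 0, q.1 1 * s, q.2 s] := by
  ext i
  fin_cases i <;> simp [curveGraph]

theorem contDiff_curveGraph : ContDiff ℝ ∞ curveGraph := by
  unfold curveGraph
  fun_prop

/-- The equation whose zeros are the solutions of `dζ/dr = -y F(x, y r, ζ)` with `ζ(1) = z`. -/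
noncomputable def characteristicMap (F : C(R3, ℝ)) (q : R3 × C(unitInterval, ℝ)) :
    R3 × C(unitInterval, ℝ) :=
  (q.1, q.2 - (EuclideanSpace.proj 2 : R3 →L[ℝ] ℝ) q.1 • (1 : C(unitInterval, ℝ))
    - (EuclideanSpace.proj 1 : R3 →L[ℝ] ℝ) q.1 • volterra (F.comp (curveGraph q)))

theorem contDiff_characteristicMap (F : C(R3, ℝ)) (hF : ContDiff ℝ ∞ F) :
    ContDiff ℝ ∞ (characteristicMap F) := by
  have h : ContDiff ℝ ∞ fun q => volterra (F.comp (curveGraph q)) := volterra.contDiff.comp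
    ((contDiff_superposition (X := unitInterval) F hF).comp contDiff_curveGraph)
  set H := fun q => volterra (F.comp (curveGraph q)) with hH
  have h1 : characteristicMap F = fun q =>
      (q.1, q.2 - (EuclideanSpace.proj 2 : R3 →L[ℝ] ℝ) q.1 • (1 : C(unitInterval, ℝ))
        - (EuclideanSpace.proj 1 : R3 →L[ℝ] ℝ) q.1 • H q) := rfl
  rw [h1]
  clear_value H
  fun_prop

/-- A shear of a product. -/
noncomputable def shearEquiv {V W : Type*} [NormedAddCommGroup V] [NormedSpace ℝ V]
    [NormedAddCommGroup W] [NormedSpace ℝ W] (B : V →L[ℝ] W) : (V × W) ≃L[ℝ] (V × W) :=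
  ContinuousLinearEquiv.equivOfInverse
    ((ContinuousLinearMap.fst ℝ V W).prod
      (ContinuousLinearMap.snd ℝ V W - B.comp (ContinuousLinearMap.fst ℝ V W)))
    ((ContinuousLinearMap.fst ℝ V W).prod
      (ContinuousLinearMap.snd ℝ V W + B.comp (ContinuousLinearMap.fst ℝ V W)))
    (fun q => by ext <;> simp) (fun q => by ext <;> simp)

/-- The nonlinear term carries the factor `y`, which vanishes at the origin, so there its derivative
is `dy` times the constant value of the term. In the direction of the curve the derivative is thus
the identity, and the whole is a shear. -/
theorem exists_hasFDerivAt_characteristicMap (F : C(R3, ℝ)) (hF : ContDiff ℝ ∞ F) :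
    ∃ A : (R3 × C(unitInterval, ℝ)) ≃L[ℝ] (R3 × C(unitInterval, ℝ)),
      HasFDerivAt (characteristicMap F)
        (A : (R3 × C(unitInterval, ℝ)) →L[ℝ] (R3 × C(unitInterval, ℝ))) 0 := by
  have h : ContDiff ℝ ∞ fun q => volterra (F.comp (curveGraph q)) := volterra.contDiff.comp
    ((contDiff_superposition (X := unitInterval) F hF).comp contDiff_curveGraph)
  have h0 := (h.differentiable (by simp) 0).hasFDerivAt
  set H := fun q => volterra (F.comp (curveGraph q))
  let π : Fin 3 → (R3 × C(unitInterval, ℝ)) →L[ℝ] ℝ := fun i =>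
    (EuclideanSpace.proj i : R3 →L[ℝ] ℝ).comp (ContinuousLinearMap.fst ℝ _ _)
  refine ⟨shearEquiv ((EuclideanSpace.proj 2 : R3 →L[ℝ] ℝ).smulRight 1
    + (EuclideanSpace.proj 1 : R3 →L[ℝ] ℝ).smulRight (H 0)), ?_⟩
  have := (ContinuousLinearMap.fst ℝ R3 C(unitInterval, ℝ)).hasFDerivAt (x := 0) |>.prodMk
    (((ContinuousLinearMap.snd ℝ R3 C(unitInterval, ℝ)).hasFDerivAt (x := 0)).sub
      ((π 2).hasFDerivAt.smul_const (1 : C(unitInterval, ℝ))) |>.sub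
        ((π 1).hasFDerivAt.smul h0))
  refine this.congr_fderiv ?_
  ext q <;> simp [shearEquiv, π]
  ring

theorem characteristicMap_eq_iff (F : C(R3, ℝ)) (p : R3) (ζ : C(unitInterval, ℝ)) :
    characteristicMap F (p, ζ) = (p, 0) ↔ ∀ r : unitInterval, ζ r = p 2 + p 1 *
      ∫ s in (r : ℝ)..1, F !₂[p 0, p 1 * s, Set.IccExtend (zero_le_one' ℝ) ζ s] := by
  have key : ∀ r : unitInterval, volterra (F.comp (curveGraph (p, ζ))) r =
      ∫ s in (r : ℝ)..1, F !₂[p 0, p 1 * s, Set.IccExtend (zero_le_one' ℝ) ζ s] := by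
    intro r
    rw [volterra_apply]
    refine intervalIntegral.integral_congr fun s hs => ?_
    rw [Set.uIcc_of_le r.2.2] at hs
    have hs' : s ∈ Set.Icc (0 : ℝ) 1 := ⟨r.2.1.trans hs.1, hs.2⟩
    simp [Set.IccExtend_of_mem _ _ hs', curveGraph_apply]
  simp only [characteristicMap, Prod.mk.injEq, true_and, ContinuousMap.ext_iff]
  refine forall_congr' fun r => ?_
  simp [key]
  constructor <;> intro h <;> linarith

end FirstIntegral

section FirstIntegral

/-- Restricting a solution of the characteristic equation to `[0, l]` and rescaling gives the
solution whose end point is the point of the original one at time `l`. -/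
theorem characteristicMap_rescale (F : C(R3, ℝ)) {p : R3} {ζ : C(unitInterval, ℝ)}
    (h : characteristicMap F (p, ζ) = (p, 0)) (l : unitInterval) :
    characteristicMap F (!₂[p 0, l * p 1, ζ l], ζ.comp ⟨fun r => l * r, by fun_prop⟩) =
      (!₂[p 0, l * p 1, ζ l], 0) := by
  rw [characteristicMap_eq_iff] at h ⊢
  intro r
  set Φ : ℝ → ℝ := fun s => F !₂[p 0, p 1 * s, Set.IccExtend (zero_le_one' ℝ) ζ s] with hΦ
  have hΦc : Continuous Φ := by
    have hc : Continuous (Set.IccExtend (zero_le_one' ℝ) ζ) := ζ.continuous.Icc_extend'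
    refine F.continuous.comp ?_
    fun_prop
  have h1 : ∫ s in (r : ℝ)..1, F !₂[p 0, l * p 1 * s, Set.IccExtend (zero_le_one' ℝ)
      (ζ.comp ⟨fun r => l * r, by fun_prop⟩) s] = ∫ s in (r : ℝ)..1, Φ (l * s) := by
    refine intervalIntegral.integral_congr fun s hs => ?_
    rw [Set.uIcc_of_le r.2.2] at hs
    have hs' : s ∈ Set.Icc (0 : ℝ) 1 := ⟨r.2.1.trans hs.1, hs.2⟩
    have hs2 : (l : ℝ) * s ∈ Set.Icc (0 : ℝ) 1 := (l * ⟨s, hs'⟩ : unitInterval).2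
    have h3 : Set.IccExtend (zero_le_one' ℝ) (ζ.comp ⟨fun r => l * r, by fun_prop⟩) s =
        Set.IccExtend (zero_le_one' ℝ) ζ (l * s) := by
      rw [Set.IccExtend_of_mem _ _ hs', Set.IccExtend_of_mem _ _ hs2]
      rfl
    simp only [hΦ, h3]
    ring_nf
  have h2 : (l : ℝ) * ∫ s in (r : ℝ)..1, Φ (l * s) = ∫ s in (l * r : ℝ)..l, Φ s := by
    rw [intervalIntegral.mul_integral_comp_mul_left, mul_one]
  have e1 := h (l * r)
  have e2 := h l
  have e3 := intervalIntegral.integral_add_adjacent_intervals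
    (hΦc.intervalIntegrable (μ := MeasureTheory.volume) (l * r : ℝ) l)
    (hΦc.intervalIntegrable (μ := MeasureTheory.volume) (l : ℝ) 1)
  simp only [ContinuousMap.comp_apply, ContinuousMap.coe_mk] at *
  simp only [Matrix.cons_val_zero, Matrix.cons_val_one, Matrix.cons_val] at *
  rw [h1, mul_right_comm, h2, e1, e2]
  simp only [Set.Icc.coe_mul] at *
  rw [← e3]
  ring

/-- The function `g` sends `p` to the height at which the characteristic through `p` meets the plane
`y = 0`. It is constant along characteristics; differentiating along one in the rescaled time gives
the equation with the extra factor `y`. -/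
theorem exists_local_first_integral (F : C(R3, ℝ)) (hF : ContDiff ℝ ∞ F) :
    ∃ g : R3 → ℝ, (∀ᶠ p in 𝓝 0, ContDiffAt ℝ ∞ g p) ∧
      fderiv ℝ g 0 (EuclideanSpace.single 2 1) = 1 ∧
      ∀ᶠ p in 𝓝 0, p 1 * fderiv ℝ g p (EuclideanSpace.single 1 1) =
        p 1 * (F p * fderiv ℝ g p (EuclideanSpace.single 2 1)) := by
  obtain ⟨A, hA⟩ := exists_hasFDerivAt_characteristicMap F hF
  obtain ⟨e, he, h0, hsm⟩ :=
    exists_openPartialHomeomorph_smooth_symm (contDiff_characteristicMap F hF) A hA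
  have hG0 : characteristicMap F 0 = 0 := by simp [characteristicMap]
  rw [hG0] at hsm
  have h0t : (0 : R3 × C(unitInterval, ℝ)) ∈ e.target := by
    have := e.map_source h0
    rwa [he, hG0] at this
  have hs0 : e.symm 0 = 0 := by
    have := e.left_inv h0
    rwa [he, hG0] at this
  obtain ⟨δ, hδ, hδS⟩ := Metric.isOpen_iff.1 e.open_source 0 h0
  have hi : Filter.Tendsto (fun p : R3 => ((p, 0) : R3 × C(unitInterval, ℝ))) (𝓝 0) (𝓝 0) :=
    (by fun_prop : Continuous fun p : R3 => ((p, 0) : R3 × C(unitInterval, ℝ))).tendsto' _ _ rfl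
  have hsc : Filter.Tendsto e.symm (𝓝 0) (𝓝 0) := by
    have := e.continuousAt_symm h0t
    rwa [ContinuousAt, hs0] at this
  set g : R3 → ℝ := fun p => (e.symm (p, 0)).2 0 with hg
  have hgsm : ∀ᶠ p in 𝓝 (0 : R3), ContDiffAt ℝ ∞ g p := by
    filter_upwards [hi.eventually hsm] with p hp
    have h1 : ContDiffAt ℝ ∞ (fun p : R3 => e.symm (p, 0)) p :=
      hp.comp p (by fun_prop)
    exact ((ContinuousMap.evalCLM ℝ (0 : unitInterval)).contDiff.comp
      contDiff_snd).contDiffAt.comp p h1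
  -- Local injectivity of the characteristic map plays the role of uniqueness for the differential
  -- equation.
  have huniq : ∀ (p : R3) (ζ : C(unitInterval, ℝ)), ‖p‖ < δ → ‖ζ‖ < δ →
      characteristicMap F (p, ζ) = (p, 0) → g p = ζ 0 := by
    intro p ζ hp hζ h
    have hmem : (p, ζ) ∈ e.source := hδS (by
      rw [mem_ball_zero_iff, Prod.norm_def]
      exact max_lt hp hζ)
    have := e.left_inv hmem
    rw [he, h] at this
    simp [hg, this]
  have hnhds : ∀ᶠ p in 𝓝 (0 : R3), ‖p‖ < δ := by
    filter_upwards [Metric.ball_mem_nhds (0 : R3) hδ] with p hp using mem_ball_zero_iff.1 hp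
  refine ⟨g, hgsm, ?_, ?_⟩
  -- For `y = 0` the solution curve is constant, so `g` restricts to the coordinate `z` on the
  -- `z`-axis.
  · have hline : ∀ᶠ t in 𝓝 (0 : ℝ), g (t • EuclideanSpace.single 2 1) = t := by
      have h1 : Filter.Tendsto (fun t : ℝ => t • (EuclideanSpace.single 2 1 : R3)) (𝓝 0) (𝓝 0) :=
        (by fun_prop : Continuous fun t : ℝ => t • (EuclideanSpace.single 2 1 : R3)).tendsto'
          _ _ (by simp)
      filter_upwards [h1.eventually hnhds, Metric.ball_mem_nhds (0 : ℝ) hδ] with t ht ht'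
      rw [huniq _ (ContinuousMap.const _ t) ht]
      · rfl
      · rw [mem_ball_zero_iff] at ht'
        exact lt_of_le_of_lt ((ContinuousMap.norm_le _ (norm_nonneg _)).2 fun _ => le_rfl) ht'
      · rw [characteristicMap_eq_iff]
        simp
    have hd : HasDerivAt (fun t : ℝ => t • (EuclideanSpace.single 2 1 : R3))
        (EuclideanSpace.single 2 1) 0 := by
      simpa using (hasDerivAt_id (0 : ℝ)).smul_const (EuclideanSpace.single 2 1 : R3)
    have hgd : HasFDerivAt g (fderiv ℝ g 0) ((0 : ℝ) • (EuclideanSpace.single 2 1 : R3)) := by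
      rw [zero_smul]
      exact (hgsm.self_of_nhds.differentiableAt (by simp)).hasFDerivAt
    have hline' : g ∘ (fun t : ℝ => t • (EuclideanSpace.single 2 1 : R3)) =ᶠ[𝓝 0] id := hline
    exact (hgd.comp_hasDerivAt (0 : ℝ) hd).unique
      ((hasDerivAt_id (0 : ℝ)).congr_of_eventuallyEq hline')
  · filter_upwards [hgsm, hi.eventually (e.open_target.mem_nhds h0t),
      (hsc.comp hi).eventually (Metric.ball_mem_nhds 0 hδ)] with p hp hpt hpb
    obtain ⟨ζ, hζ⟩ : ∃ ζ, e.symm (p, 0) = (p, ζ) := by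
      have h1 := e.right_inv hpt
      rw [he] at h1
      have h2 : (e.symm (p, 0)).1 = p := congrArg Prod.fst h1
      exact ⟨_, Prod.ext h2 rfl⟩
    have hsol : characteristicMap F (p, ζ) = (p, 0) := by
      rw [← hζ, ← he, e.right_inv hpt]
    rw [Function.comp_apply, hζ, dist_zero_right, Prod.norm_def, max_lt_iff] at hpb
    have hgp : g p = ζ 0 := by simp [hg, hζ]
    set Φ : ℝ → ℝ := fun s => F !₂[p 0, p 1 * s, Set.IccExtend (zero_le_one' ℝ) ζ s] with hΦ
    have hΦc : Continuous Φ := by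
      have hc : Continuous (Set.IccExtend (zero_le_one' ℝ) ζ) := ζ.continuous.Icc_extend'
      refine F.continuous.comp ?_
      fun_prop
    set Z : ℝ → ℝ := fun l => p 2 + p 1 * ∫ s in l..1, Φ s with hZ
    have hZζ : ∀ l : unitInterval, ζ l = Z l := (characteristicMap_eq_iff F p ζ).1 hsol
    have hZ1 : Z 1 = p 2 := by simp [hZ]
    have hζ1 : ζ 1 = p 2 := by rw [hZζ]; exact hZ1
    have hΦ1 : Φ 1 = F p := by
      simp only [hΦ]
      congr 1
      ext i
      fin_cases i <;> simp [hζ1]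
    have hZd : HasDerivAt Z (p 1 * -F p) 1 := by
      rw [← hΦ1]
      exact ((intervalIntegral.integral_hasDerivAt_left (hΦc.intervalIntegrable _ _)
        (hΦc.stronglyMeasurableAtFilter _ _) hΦc.continuousAt).const_mul (p 1)).const_add _
    let P : ℝ → R3 := fun l => p 0 • EuclideanSpace.single 0 1 +
      ((l * p 1) • EuclideanSpace.single 1 1 + Z l • EuclideanSpace.single 2 1)
    have hP : ∀ l, P l = !₂[p 0, l * p 1, Z l] := by
      intro l
      ext i
      fin_cases i <;> simp [P]
    have hP1 : P 1 = p := by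
      rw [hP]
      ext i
      fin_cases i <;> simp [hZ1]
    have hPd : HasDerivAt P (p 1 • EuclideanSpace.single 1 1 +
        (p 1 * -F p) • EuclideanSpace.single 2 1) 1 := by
      have h1 : HasDerivAt (fun l : ℝ => l * p 1) (p 1) 1 := by
        simpa using (hasDerivAt_id (1 : ℝ)).mul_const (p 1)
      exact ((h1.smul_const _).add (hZd.smul_const _)).const_add _
    -- The curve is only available for times in `[0, 1]`, so `l` approaches `1` from the left; a
    -- one-sided derivative suffices.
    have hconst : ∀ᶠ l in 𝓝[Set.Iic 1] (1 : ℝ), g (P l) = g p := by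
      have h1 : ∀ᶠ l in 𝓝[Set.Iic 1] (1 : ℝ), ‖P l‖ < δ := by
        have := hPd.continuousAt.norm.tendsto
        rw [hP1] at this
        exact (this.eventually (gt_mem_nhds hpb.1)).filter_mono nhdsWithin_le_nhds
      have h2 : ∀ᶠ l in 𝓝[Set.Iic 1] (1 : ℝ), (0 : ℝ) < l :=
        (lt_mem_nhds one_pos).filter_mono nhdsWithin_le_nhds
      filter_upwards [h1, h2, self_mem_nhdsWithin] with l hl hl0 hl1
      have hz := hZζ ⟨l, hl0.le, hl1⟩
      have hr := characteristicMap_rescale F hsol ⟨l, hl0.le, hl1⟩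
      simp only [hz, ← hP] at hr
      rw [huniq _ _ hl _ hr, hgp]
      · simp
      · refine lt_of_le_of_lt ((ContinuousMap.norm_le _ (norm_nonneg _)).2 fun r => ?_) hpb.2
        exact ζ.norm_coe_le_norm _
    have hgd : HasFDerivAt g (fderiv ℝ g p) (P 1) := by
      rw [hP1]
      exact (hp.differentiableAt (by simp)).hasFDerivAt
    have hd1 := (hgd.comp_hasDerivAt (1 : ℝ) hPd).hasDerivWithinAt (s := Set.Iic 1)
    have hd2 : HasDerivWithinAt (g ∘ P) 0 (Set.Iic 1) 1 :=
      (hasDerivWithinAt_const (1 : ℝ) (Set.Iic 1) (g p)).congr_of_eventuallyEq hconst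
        (by simp [hP1])
    have := (uniqueDiffWithinAt_Iic (1 : ℝ)).eq_deriv _ hd1 hd2
    simp only [map_add, map_smul, smul_eq_mul] at this
    linarith

end FirstIntegral

/-! ### The linear involution and radial cut-offs -/

section Cutoff

/-- The involution `rotR3` as a continuous linear map. -/
noncomputable def rotCLM : R3 →L[ℝ] R3 :=
  (EuclideanSpace.proj 0 : R3 →L[ℝ] ℝ).smulRight (EuclideanSpace.single 0 1)
    - (EuclideanSpace.proj 1 : R3 →L[ℝ] ℝ).smulRight (EuclideanSpace.single 1 1)
    - (EuclideanSpace.proj 2 : R3 →L[ℝ] ℝ).smulRight (EuclideanSpace.single 2 1)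

theorem rotCLM_apply (p : R3) : rotCLM p = rotR3 p := by
  ext i
  fin_cases i <;> simp [rotCLM, rotR3]

theorem norm_rotR3 (p : R3) : ‖rotR3 p‖ = ‖p‖ := by
  simp [EuclideanSpace.norm_eq, rotR3, Fin.sum_univ_three]

theorem rotR3_rotR3 (p : R3) : rotR3 (rotR3 p) = p := by
  ext i
  fin_cases i <;> simp [rotR3]

/-- A radial cut-off function: `1` on the unit ball, `0` outside the ball of radius `2`. -/
noncomputable def radialCutoff (p : R3) : ℝ := Real.smoothTransition (2 - ‖p‖ ^ 2)

theorem contDiff_radialCutoff : ContDiff ℝ ∞ radialCutoff :=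
  Real.smoothTransition.contDiff.comp (contDiff_const.sub (contDiff_norm_sq ℝ))

theorem radialCutoff_of_norm_le {p : R3} (hp : ‖p‖ ≤ 1) : radialCutoff p = 1 :=
  Real.smoothTransition.one_of_one_le (by nlinarith [norm_nonneg p])

theorem radialCutoff_of_le_norm {p : R3} (hp : 2 ≤ ‖p‖) : radialCutoff p = 0 :=
  Real.smoothTransition.zero_of_nonpos (by nlinarith)

theorem radialCutoff_mem_Icc (p : R3) : radialCutoff p ∈ Set.Icc (0 : ℝ) 1 :=
  ⟨Real.smoothTransition.nonneg _, Real.smoothTransition.le_one _⟩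

theorem radialCutoff_smul_rotR3 (c : ℝ) (p : R3) :
    radialCutoff (c • rotR3 p) = radialCutoff (c • p) := by
  simp [radialCutoff, norm_smul, norm_rotR3]

theorem exists_lipschitzWith_radialCutoff : ∃ K, LipschitzWith K radialCutoff := by
  refine contDiff_radialCutoff.lipschitzWith_of_hasCompactSupport ?_ (by simp)
  refine HasCompactSupport.intro (isCompact_closedBall (0 : R3) 2) fun p hp => ?_
  rw [mem_closedBall_zero_iff, not_le] at hp
  exact radialCutoff_of_le_norm hp.le

theorem radialCutoff_inv_smul_of_norm_le {ε : ℝ} (hε : 0 < ε) {p : R3} (hp : ‖p‖ ≤ ε) :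
    radialCutoff (ε⁻¹ • p) = 1 := by
  refine radialCutoff_of_norm_le ?_
  rw [norm_smul, norm_inv, Real.norm_of_nonneg hε.le, inv_mul_le_iff₀ hε]
  simpa using hp

theorem radialCutoff_inv_smul_of_le_norm {ε : ℝ} (hε : 0 < ε) {p : R3} (hp : 2 * ε ≤ ‖p‖) :
    radialCutoff (ε⁻¹ • p) = 0 := by
  refine radialCutoff_of_le_norm ?_
  rw [norm_smul, norm_inv, Real.norm_of_nonneg hε.le, le_inv_mul_iff₀ hε]
  linarith

theorem radialCutoff_inv_smul_eventuallyEq {ε : ℝ} (hε : 0 < ε) :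
    ∀ᶠ p in 𝓝 (0 : R3), radialCutoff (ε⁻¹ • p) = 1 := by
  filter_upwards [Metric.ball_mem_nhds (0 : R3) hε] with p hp
  exact radialCutoff_inv_smul_of_norm_le hε (mem_ball_zero_iff.1 hp).le

/-- Multiplying by a cut-off function makes a locally smooth map globally smooth. -/
theorem contDiff_radialCutoff_smul {F : Type*} [NormedAddCommGroup F] [NormedSpace ℝ F]
    {f : R3 → F} {ε : ℝ} (hε : 0 < ε) (hf : ∀ p, ‖p‖ < 3 * ε → ContDiffAt ℝ ∞ f p) :
    ContDiff ℝ ∞ fun p => radialCutoff (ε⁻¹ • p) • f p := by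
  rw [contDiff_iff_contDiffAt]
  intro p
  by_cases hp : ‖p‖ < 3 * ε
  · exact (contDiff_radialCutoff.comp (contDiff_const_smul ε⁻¹)).contDiffAt.smul (hf p hp)
  · have h : (fun p => radialCutoff (ε⁻¹ • p) • f p) =ᶠ[𝓝 p] fun _ => 0 := by
      have : ∀ᶠ q in 𝓝 p, 2 * ε < ‖q‖ :=
        continuous_norm.continuousAt.eventually (lt_mem_nhds (by linarith))
      filter_upwards [this] with q hq
      rw [radialCutoff_inv_smul_of_le_norm hε hq.le, zero_smul]
    exact contDiffAt_const.congr_of_eventuallyEq h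

theorem exists_pos_of_eventually_nhds_zero {P : R3 → Prop} (h : ∀ᶠ p in 𝓝 (0 : R3), P p) :
    ∃ ε > 0, ∀ p, ‖p‖ < 3 * ε → P p := by
  obtain ⟨δ, hδ, H⟩ := Metric.eventually_nhds_iff_ball.1 h
  exact ⟨δ / 3, by positivity, fun p hp => H p (by rw [mem_ball_zero_iff]; linarith)⟩

theorem exists_contDiff_eventuallyEq {F : Type*} [NormedAddCommGroup F] [NormedSpace ℝ F]
    {f : R3 → F} (hf : ∀ᶠ p in 𝓝 0, ContDiffAt ℝ ∞ f p) :
    ∃ g : R3 → F, ContDiff ℝ ∞ g ∧ g =ᶠ[𝓝 0] f := by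
  obtain ⟨ε, hε, h⟩ := exists_pos_of_eventually_nhds_zero hf
  refine ⟨_, contDiff_radialCutoff_smul hε h, ?_⟩
  filter_upwards [radialCutoff_inv_smul_eventuallyEq hε] with p hp
  rw [hp, one_smul]

end Cutoff

/-! ### First integrals with the factor `y` removed -/

/-- Near the origin, the equation `∂g/∂y = F ∂g/∂z` has a smooth solution with `∂g/∂z = 1` at the
origin. -/
theorem exists_first_integral {F : R3 → ℝ} (hF : ContDiff ℝ ∞ F) :
    ∃ g : R3 → ℝ, ContDiff ℝ ∞ g ∧
      fderiv ℝ g 0 (EuclideanSpace.single 2 1) = 1 ∧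
      ∀ᶠ p in 𝓝 0, fderiv ℝ g p (EuclideanSpace.single 1 1) =
        F p * fderiv ℝ g p (EuclideanSpace.single 2 1) := by
  obtain ⟨g₀, hs₀, hz₀, hpde₀⟩ := exists_local_first_integral ⟨F, hF.continuous⟩ hF
  obtain ⟨g, hg, hgg₀⟩ := exists_contDiff_eventuallyEq hs₀
  refine ⟨g, hg, by rw [hgg₀.fderiv_eq, hz₀], ?_⟩
  have hpde : ∀ᶠ p in 𝓝 0, p 1 * fderiv ℝ g p (EuclideanSpace.single 1 1) =
      p 1 * (F p * fderiv ℝ g p (EuclideanSpace.single 2 1)) := by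
    filter_upwards [hgg₀.eventuallyEq_nhds, hpde₀] with p hp hp'
    rw [hp.fderiv_eq]
    exact hp'
  have hc : Continuous (fderiv ℝ g) := hg.continuous_fderiv (by simp)
  filter_upwards [hpde.eventually_nhds] with p hp
  -- The factor `y` cancels off the plane `y = 0`; points of that plane are limits along the
  -- `y`-direction, and both sides are continuous.
  have hline : Continuous fun t : ℝ => p + t • (EuclideanSpace.single 1 1 : R3) := by fun_prop
  have h1 : ∀ᶠ t in 𝓝[≠] (0 : ℝ), (p + t • (EuclideanSpace.single 1 1 : R3)) 1 ≠ 0 := by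
    by_cases hp1 : p 1 = 0
    · filter_upwards [self_mem_nhdsWithin] with t ht
      simpa [hp1] using ht
    · have : Continuous fun t : ℝ => (p + t • (EuclideanSpace.single 1 1 : R3)) 1 := by fun_prop
      exact (this.continuousAt.eventually (isOpen_ne.mem_nhds (by simpa using hp1))).filter_mono
        nhdsWithin_le_nhds
  have h2 : ∀ᶠ t in 𝓝[≠] (0 : ℝ),
      fderiv ℝ g (p + t • EuclideanSpace.single 1 1) (EuclideanSpace.single 1 1) =
        F (p + t • EuclideanSpace.single 1 1) *
          fderiv ℝ g (p + t • EuclideanSpace.single 1 1) (EuclideanSpace.single 2 1) := by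
    have h3 := ((hline.tendsto' 0 p (by simp)).eventually hp).filter_mono
      (nhdsWithin_le_nhds (s := {0}ᶜ))
    filter_upwards [h1, h3] with t ht ht'
    exact mul_left_cancel₀ ht ht'
  have hl : Filter.Tendsto (fun t : ℝ => fderiv ℝ g (p + t • EuclideanSpace.single 1 1)
      (EuclideanSpace.single 1 1)) (𝓝[≠] 0)
      (𝓝 (fderiv ℝ g p (EuclideanSpace.single 1 1))) :=
    (((hc.comp hline).clm_apply continuous_const).tendsto' 0 _ (by simp)).mono_left
      nhdsWithin_le_nhds
  have hr : Filter.Tendsto (fun t : ℝ => F (p + t • EuclideanSpace.single 1 1) *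
      fderiv ℝ g (p + t • EuclideanSpace.single 1 1) (EuclideanSpace.single 2 1)) (𝓝[≠] 0)
      (𝓝 (F p * fderiv ℝ g p (EuclideanSpace.single 2 1))) :=
    (((hF.continuous.comp hline).mul
      ((hc.comp hline).clm_apply continuous_const)).tendsto' 0 _ (by simp)).mono_left
      nhdsWithin_le_nhds
  exact tendsto_nhds_unique (hl.congr' h2) hr

/-! ### Realizing germs close to the identity -/

section Perturbation

/-- A small Lipschitz perturbation of the identity is a diffeomorphism. -/
theorem exists_diffeomorph_id_add {h : R3 → R3} (hs : ContDiff ℝ ∞ h)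
    (hl : LipschitzWith (1 / 2) h) :
    ∃ D : R3 ≃ₘ^∞⟮𝓡 3, 𝓡 3⟯ R3, ∀ p, D p = p + h p := by
  set f : R3 → R3 := fun p => p + h p with hf
  have hfs : ContDiff ℝ ∞ f := contDiff_id.add hs
  have happ : ApproximatesLinearOn f ((ContinuousLinearEquiv.refl ℝ R3 : R3 ≃L[ℝ] R3) : R3 →L[ℝ] R3)
      Set.univ (1 / 2) := by
    intro x _ y _
    have := hl.dist_le_mul x y
    rw [dist_eq_norm, dist_eq_norm] at this
    have e : f x - f y - ((ContinuousLinearEquiv.refl ℝ R3 : R3 ≃L[ℝ] R3) : R3 →L[ℝ] R3) (x - y) =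
        h x - h y := by
      simp only [hf, ContinuousLinearEquiv.coe_refl, ContinuousLinearMap.coe_id', id_eq]
      abel
    rw [e]
    exact this
  have hc : Subsingleton R3 ∨ (1 / 2 : NNReal) <
      ‖((ContinuousLinearEquiv.refl ℝ R3).symm : R3 →L[ℝ] R3)‖₊⁻¹ := by
    right
    have : ‖((ContinuousLinearEquiv.refl ℝ R3).symm : R3 →L[ℝ] R3)‖₊ = 1 := by
      simp
    rw [this]
    norm_num
  set H := happ.toHomeomorph f hc with hH
  have hHf : ⇑H = f := rfl
  -- The derivative `id + dh` is invertible by the Neumann series, as `dh` has norm at most `1 / 2`.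
  have hd : ∀ p, ∃ B : R3 ≃L[ℝ] R3, HasFDerivAt H (B : R3 →L[ℝ] R3) p := by
    intro p
    have hn : ‖-fderiv ℝ h p‖ < 1 := by
      rw [norm_neg]
      have := norm_fderiv_le_of_lipschitz ℝ hl (x₀ := p)
      refine lt_of_le_of_lt this ?_
      norm_num
    refine ⟨ContinuousLinearEquiv.unitsEquiv ℝ R3 (Units.oneSub _ hn), ?_⟩
    have h1 := (hasFDerivAt_id (𝕜 := ℝ) p).add (hs.differentiable (by simp) p).hasFDerivAt
    rw [hHf]
    refine h1.congr_fderiv ?_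
    ext v
    simp
  choose B hB using hd
  exact ⟨{ toEquiv := H.toEquiv
           contMDiff_toFun := hfs.contMDiff
           contMDiff_invFun := (H.contDiff_symm hB hfs).contMDiff }, fun p => rfl⟩

/-- A map is realizable if, near the origin, it agrees with the time-one map of a compactly
supported equivariant isotopy of `ℝ³`. -/
def IsRealizable (φ : R3 → R3) : Prop :=
  ∃ ψ : ℝ → R3 ≃ₘ^∞⟮𝓡 3, 𝓡 3⟯ R3, IsEquivariantIsotopy rotR3 ψ ∧
    (∃ R : ℝ, ∀ t p, R ≤ ‖p‖ → ψ t p = p) ∧ ∀ᶠ p in 𝓝 (0 : R3), ψ 1 p = φ p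

theorem contMDiffOn_isotopy_iff {f : ℝ × R3 → R3} {s : Set (ℝ × R3)} :
    ContMDiffOn (𝓘(ℝ, ℝ).prod (𝓡 3)) (𝓡 3) ∞ f s ↔ ContDiffOn ℝ ∞ f s := by
  rw [← modelWithCornersSelf_prod, chartedSpaceSelf_prod, contMDiffOn_iff_contDiffOn]

theorem IsRealizable.congr {φ φ' : R3 → R3} (h : IsRealizable φ)
    (hφ : ∀ᶠ p in 𝓝 (0 : R3), φ p = φ' p) : IsRealizable φ' := by
  obtain ⟨ψ, h1, h2, h3⟩ := h
  exact ⟨ψ, h1, h2, by filter_upwards [h3, hφ] with p hp hp' using hp.trans hp'⟩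

/-- The isotopies are composed time by time. Since the inner germ fixes the origin, it stays where
the outer isotopy agrees with its germ. -/
theorem IsRealizable.comp {φ φ' : R3 → R3} (h : IsRealizable φ) (h' : IsRealizable φ')
    (hc : ContinuousAt φ' 0) (h0 : φ' 0 = 0) : IsRealizable (φ ∘ φ') := by
  obtain ⟨ψ, h1, ⟨R, hR⟩, h3⟩ := h
  obtain ⟨ψ', h1', ⟨R', hR'⟩, h3'⟩ := h'
  refine ⟨fun t => (ψ' t).trans (ψ t), ⟨?_, ?_, ?_⟩, ⟨max R R', ?_⟩, ?_⟩
  · have hs := contMDiffOn_isotopy_iff.1 h1.smooth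
    have hs' := contMDiffOn_isotopy_iff.1 h1'.smooth
    rw [contMDiffOn_isotopy_iff]
    have : ContDiffOn ℝ ∞ (fun q : ℝ × R3 => (q.1, ψ' q.1 q.2)) (Set.Icc (0 : ℝ) 1 ×ˢ Set.univ) :=
      contDiff_fst.contDiffOn.prodMk hs'
    exact hs.comp this fun q hq => ⟨hq.1, Set.mem_univ _⟩
  · intro p
    simp [h1.zero, h1'.zero]
  · intro t ht p
    simp [h1.equivariant t ht, h1'.equivariant t ht]
  · intro t p hp
    have e' := hR' t p ((le_max_right _ _).trans hp)
    have e := hR t p ((le_max_left _ _).trans hp)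
    simp [e', e]
  · rw [ContinuousAt, h0] at hc
    filter_upwards [h3', hc.eventually h3] with p hp hp'
    simp [hp, hp']

/-- The straight-line isotopy `p + t h(p)` works: for `t` in `[0, 1]` the perturbation keeps its
Lipschitz constant. -/
theorem isRealizable_id_add {h : R3 → R3} (hs : ContDiff ℝ ∞ h)
    (hl : LipschitzWith (1 / 2) h) (hu : ∀ p, h (rotR3 p) = rotR3 (h p))
    {R : ℝ} (hR : ∀ p, R ≤ ‖p‖ → h p = 0) : IsRealizable fun p => p + h p := by
  -- A diffeomorphism is required for every real `t`, so time is clamped to `[0, 1]`.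
  let c : ℝ → ℝ := fun t => max 0 (min 1 t)
  have hc0 : ∀ t, 0 ≤ c t := fun t => le_max_left _ _
  have hc1 : ∀ t, c t ≤ 1 := fun t => max_le zero_le_one (min_le_left _ _)
  have hc : ∀ t ∈ Set.Icc (0 : ℝ) 1, c t = t := fun t ht => by
    simp only [c]
    rw [min_eq_right ht.2, max_eq_right ht.1]
  have hD : ∀ t : ℝ, ∃ D : R3 ≃ₘ^∞⟮𝓡 3, 𝓡 3⟯ R3, ∀ p, D p = p + c t • h p := by
    intro t
    refine exists_diffeomorph_id_add (h := fun p => c t • h p) (hs.const_smul _) ?_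
    refine LipschitzWith.of_dist_le_mul fun p q => ?_
    rw [dist_smul₀, Real.norm_of_nonneg (hc0 t)]
    exact (mul_le_of_le_one_left dist_nonneg (hc1 t)).trans (hl.dist_le_mul p q)
  choose ψ hψ using hD
  refine ⟨ψ, ⟨?_, ?_, ?_⟩, ⟨R, ?_⟩, ?_⟩
  · rw [contMDiffOn_isotopy_iff]
    have : ContDiff ℝ ∞ fun q : ℝ × R3 => q.2 + q.1 • h q.2 :=
      contDiff_snd.add (contDiff_fst.smul (hs.comp contDiff_snd))
    refine this.contDiffOn.congr fun q hq => ?_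
    rw [hψ, hc _ hq.1]
  · intro p
    rw [hψ, hc 0 (by simp), zero_smul, add_zero]
  · intro t _ p
    rw [hψ, hψ, hu]
    simp only [← rotCLM_apply, map_add, map_smul]
  · intro t p hp
    rw [hψ, hR p hp, smul_zero, add_zero]
  · refine Filter.Eventually.of_forall fun p => ?_
    rw [hψ, hc 1 (by simp), one_smul]

/-- An equivariant map fixing the origin, with derivative close to the identity there, is
realizable. -/
theorem exists_pos_forall_isRealizable : ∃ c > 0, ∀ φ : R3 → R3, ContDiff ℝ ∞ φ → φ 0 = 0 →
    (∀ p, φ (rotR3 p) = rotR3 (φ p)) → ‖fderiv ℝ φ 0 - ContinuousLinearMap.id ℝ R3‖ < c →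
    IsRealizable φ := by
  obtain ⟨K, hK⟩ := exists_lipschitzWith_radialCutoff
  -- Near the origin `φ - id` is `2c`-Lipschitz: one `c` bounds its derivative at the origin, the
  -- other the linearization error. The cut-off at scale `ε` has Lipschitz constant `K / ε` and
  -- multiplies values of size at most `4cε`, so the product has constant `2c(1 + 2K)`, independent
  -- of `ε`; this has to be `1 / 2`.
  set c : ℝ := 1 / (4 * (1 + 2 * K)) with hc
  have hcpos : 0 < c := by positivity
  have hcK : 2 * c * (1 + 2 * K) = 1 / 2 := by
    rw [hc]
    field_simp
    norm_num
  refine ⟨c, hcpos, fun φ hφ h0 hu hn => ?_⟩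
  set k : R3 → R3 := fun p => φ p - p with hk
  have hks : ContDiff ℝ ∞ k := hφ.sub contDiff_id
  have hk0 : k 0 = 0 := by simp [hk, h0]
  have hkd : HasStrictFDerivAt k (fderiv ℝ φ 0 - ContinuousLinearMap.id ℝ R3) 0 :=
    (hφ.contDiffAt.hasStrictFDerivAt (by simp)).sub (hasStrictFDerivAt_id 0)
  obtain ⟨s, hs, happ⟩ := hkd.approximates_deriv_on_nhds (c := ⟨c, hcpos.le⟩) (Or.inr hcpos)
  obtain ⟨ε, hε, hεs⟩ := exists_pos_of_eventually_nhds_zero (P := (· ∈ s)) hs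
  have hkl : ∀ p q, ‖p‖ < 3 * ε → ‖q‖ < 3 * ε → ‖k p - k q‖ ≤ 2 * c * ‖p - q‖ := by
    intro p q hp hq
    have h1 := happ p (hεs p hp) q (hεs q hq)
    have h2 := (fderiv ℝ φ 0 - ContinuousLinearMap.id ℝ R3).le_of_opNorm_le hn.le (p - q)
    have h3 := norm_add_le (k p - k q - (fderiv ℝ φ 0 - ContinuousLinearMap.id ℝ R3) (p - q))
      ((fderiv ℝ φ 0 - ContinuousLinearMap.id ℝ R3) (p - q))
    rw [sub_add_cancel] at h3
    change _ ≤ c * _ at h1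
    linarith
  set χ : R3 → ℝ := fun p => radialCutoff (ε⁻¹ • p) with hχ
  have hχl : ∀ p q, |χ p - χ q| ≤ K * ε⁻¹ * ‖p - q‖ := by
    intro p q
    have := hK.dist_le_mul (ε⁻¹ • p) (ε⁻¹ • q)
    rwa [dist_smul₀, Real.norm_of_nonneg (by positivity), Real.dist_eq, dist_eq_norm,
      ← mul_assoc] at this
  have hχ0 : ∀ p, 2 * ε ≤ ‖p‖ → χ p = 0 := fun p => radialCutoff_inv_smul_of_le_norm hε
  have hχI : ∀ p, |χ p| ≤ 1 := fun p => by
    rw [abs_of_nonneg (radialCutoff_mem_Icc _).1]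
    exact (radialCutoff_mem_Icc _).2
  have hkb : ∀ p, ‖p‖ < 2 * ε → ‖k p‖ ≤ 2 * c * (2 * ε) := by
    intro p hp
    have := hkl p 0 (by linarith) (by simpa using hε)
    rw [hk0, sub_zero, sub_zero] at this
    exact this.trans (mul_le_mul_of_nonneg_left hp.le (by positivity))
  have hprod : ∀ p q, ‖p‖ < 2 * ε → |χ p - χ q| * ‖k p‖ ≤ 2 * c * (2 * K) * ‖p - q‖ := by
    intro p q hp
    calc |χ p - χ q| * ‖k p‖ ≤ (K * ε⁻¹ * ‖p - q‖) * (2 * c * (2 * ε)) :=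
          mul_le_mul (hχl p q) (hkb p hp) (norm_nonneg _) (by positivity)
      _ = 2 * c * (2 * K) * ‖p - q‖ := by field_simp
  -- Only `p` has to lie in the support ball: a `q` outside the larger ball has cut-off value zero.
  -- By symmetry this covers all pairs except those where both terms vanish.
  have hone : ∀ p q, ‖p‖ < 2 * ε → ‖χ p • k p - χ q • k q‖ ≤ 1 / 2 * ‖p - q‖ := by
    intro p q hp
    have hnn := norm_nonneg (p - q)
    have h2 := hprod p q hp
    by_cases hq : ‖q‖ < 3 * ε
    · have e : χ p • k p - χ q • k q = (χ p - χ q) • k p + χ q • (k p - k q) := by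
        module
      rw [e]
      have h1 := norm_add_le ((χ p - χ q) • k p) (χ q • (k p - k q))
      rw [norm_smul, norm_smul, Real.norm_eq_abs, Real.norm_eq_abs] at h1
      have h3 := mul_le_of_le_one_left (norm_nonneg (k p - k q)) (hχI q)
      have h4 := hkl p q (by linarith) hq
      nlinarith
    · have hq0 : χ q = 0 := hχ0 q (by linarith)
      rw [hq0, sub_zero] at h2
      rw [hq0, zero_smul, sub_zero, norm_smul, Real.norm_eq_abs]
      nlinarith [mul_nonneg hcpos.le hnn]
  have hL : LipschitzWith (1 / 2) fun p => χ p • k p := by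
    refine LipschitzWith.of_dist_le_mul fun p q => ?_
    rw [dist_eq_norm, dist_eq_norm]
    push_cast
    by_cases hp : ‖p‖ < 2 * ε
    · exact hone p q hp
    · by_cases hq : ‖q‖ < 2 * ε
      · rw [norm_sub_rev, norm_sub_rev p]
        exact hone q p hq
      · rw [hχ0 p (not_lt.1 hp), hχ0 q (not_lt.1 hq)]
        simp
  refine (isRealizable_id_add (h := fun p => χ p • k p)
    (contDiff_radialCutoff_smul hε fun p _ => hks.contDiffAt) hL (fun p => ?_)
    (R := 2 * ε) (fun p hp => by rw [hχ0 p hp, zero_smul])).congr ?_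
  · have e1 : χ (rotR3 p) = χ p := radialCutoff_smul_rotR3 _ _
    have e2 : k (rotR3 p) = rotR3 (k p) := by
      simp only [hk, hu]
      simp only [← rotCLM_apply, map_sub]
    rw [e1, e2, ← rotCLM_apply, ← rotCLM_apply, map_smul]
  · filter_upwards [radialCutoff_inv_smul_eventuallyEq hε] with p hp
    simp [hχ, hp, hk]

end Perturbation

/-! ### Realizing equivariant linear maps -/

section Linear

/-- For nearby times `γ t` composed with the inverse of `γ s` is close to the identity, hence
realizable. Realizability of these quotients is transitive, so connectedness of `[0, 1]` carries it
from `0` to `1`. -/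
theorem isRealizable_of_path {γ : ℝ → R3 →L[ℝ] R3} (hγ : Continuous γ) (h0 : γ 0 = 1)
    (hunit : ∀ s ∈ Set.Icc (0 : ℝ) 1, IsUnit (γ s))
    (hu : ∀ s p, γ s (rotR3 p) = rotR3 (γ s p)) : IsRealizable (γ 1) := by
  obtain ⟨c, hc, H⟩ := exists_pos_forall_isRealizable
  have hηu : ∀ s ∈ Set.Icc (0 : ℝ) 1, ∀ p,
      Ring.inverse (γ s) (rotR3 p) = rotR3 (Ring.inverse (γ s) p) := by
    intro s hs p
    have h1 : ∀ q, γ s (Ring.inverse (γ s) q) = q := fun q => by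
      rw [← mul_apply_eq_comp, Ring.mul_inverse_cancel _ (hunit s hs)]
      rfl
    have h2 : ∀ q, Ring.inverse (γ s) (γ s q) = q := fun q => by
      rw [← mul_apply_eq_comp, Ring.inverse_mul_cancel _ (hunit s hs)]
      rfl
    rw [← h2 (rotR3 (Ring.inverse (γ s) p)), hu, h1]
  have hlin : ∀ A : R3 →L[ℝ] R3, (∀ p, A (rotR3 p) = rotR3 (A p)) → ‖A - 1‖ < c →
      IsRealizable A := by
    intro A hA hn
    refine H A A.contDiff (map_zero A) hA ?_
    rw [A.fderiv]
    exact hn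
  have key := isPreconnected_Icc (a := (0 : ℝ)) (b := 1) |>.induction₂'
    (fun s t => IsRealizable (γ t * Ring.inverse (γ s))) ?_ ?_
    (x := 0) (y := 1) (by simp) (by simp)
  · simpa [h0] using key
  · intro s hs
    have hinv : ContinuousAt (fun t => Ring.inverse (γ t)) s := by
      obtain ⟨B, hB⟩ := hunit s hs
      have := NormedRing.inverse_continuousAt B
      rw [hB] at this
      exact this.comp hγ.continuousAt
    have e : γ s * Ring.inverse (γ s) = 1 := Ring.mul_inverse_cancel _ (hunit s hs)
    have hc1 : ContinuousAt (fun t => ‖γ t * Ring.inverse (γ s) - 1‖) s :=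
      ((hγ.continuousAt.mul continuousAt_const).sub continuousAt_const).norm
    have hc2 : ContinuousAt (fun t => ‖γ s * Ring.inverse (γ t) - 1‖) s :=
      ((continuousAt_const.mul hinv).sub continuousAt_const).norm
    have n1 := (hc1.eventually (gt_mem_nhds (by simpa [e] using hc))).filter_mono
      (nhdsWithin_le_nhds (s := Set.Icc (0 : ℝ) 1))
    have n2 := (hc2.eventually (gt_mem_nhds (by simpa [e] using hc))).filter_mono
      (nhdsWithin_le_nhds (s := Set.Icc (0 : ℝ) 1))
    filter_upwards [n1, n2, self_mem_nhdsWithin] with t h1 h2 ht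
    refine ⟨hlin _ (fun p => ?_) h1, hlin _ (fun p => ?_) h2⟩
    · simp [hηu s hs, hu]
    · simp [hηu t ht, hu]
  · intro r s t hr hs ht h1 h2
    have := h2.comp h1 (by fun_prop) (map_zero _)
    refine this.congr (Filter.Eventually.of_forall fun p => ?_)
    have e : Ring.inverse (γ s) * γ s = 1 := Ring.inverse_mul_cancel _ (hunit s hs)
    rw [Function.comp_apply, ← mul_apply_eq_comp, mul_assoc, ← mul_assoc _ (γ s), e,
      one_mul]

/-- Multiplication by a complex number in the `yz`-plane. -/
noncomputable def complexMulCLM (w : ℂ) : R3 →L[ℝ] R3 :=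
  (EuclideanSpace.proj 0 : R3 →L[ℝ] ℝ).smulRight (EuclideanSpace.single 0 1)
    + w.re • ((EuclideanSpace.proj 1 : R3 →L[ℝ] ℝ).smulRight (EuclideanSpace.single 1 1)
      + (EuclideanSpace.proj 2 : R3 →L[ℝ] ℝ).smulRight (EuclideanSpace.single 2 1))
    + w.im • ((EuclideanSpace.proj 1 : R3 →L[ℝ] ℝ).smulRight (EuclideanSpace.single 2 1)
      - (EuclideanSpace.proj 2 : R3 →L[ℝ] ℝ).smulRight (EuclideanSpace.single 1 1))

theorem complexMulCLM_apply (w : ℂ) (p : R3) :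
    complexMulCLM w p = !₂[p 0, w.re * p 1 - w.im * p 2, w.re * p 2 + w.im * p 1] := by
  ext i
  fin_cases i <;> simp [complexMulCLM]
  ring

theorem complexMulCLM_mul (w w' : ℂ) :
    complexMulCLM w * complexMulCLM w' = complexMulCLM (w * w') := by
  ext p i
  fin_cases i <;> simp [complexMulCLM_apply] <;> ring

theorem complexMulCLM_one : complexMulCLM 1 = 1 := by
  ext p i
  fin_cases i <;> simp [complexMulCLM_apply]

theorem complexMulCLM_rotR3 (w : ℂ) (p : R3) :
    complexMulCLM w (rotR3 p) = rotR3 (complexMulCLM w p) := by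
  ext i
  fin_cases i <;> simp [complexMulCLM_apply, rotR3] <;> ring

/-- The path `exp (s log w)` joins `1` to `w` through nonzero complex numbers. -/
theorem isRealizable_complexMulCLM {w : ℂ} (hw : w ≠ 0) : IsRealizable (complexMulCLM w) := by
  have hcont : Continuous complexMulCLM := by
    unfold complexMulCLM
    fun_prop
  have h := isRealizable_of_path (γ := fun s => complexMulCLM (Complex.exp (s * Complex.log w)))
    (hcont.comp (by fun_prop)) (by simp [complexMulCLM_one]) (fun s _ => ?_)
    (fun s p => complexMulCLM_rotR3 _ p)
  · simpa [Complex.exp_log hw] using h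
  · refine ⟨⟨complexMulCLM (Complex.exp (s * Complex.log w)),
      complexMulCLM (Complex.exp (-(s * Complex.log w))), ?_, ?_⟩, rfl⟩
    · rw [complexMulCLM_mul, ← Complex.exp_add, add_neg_cancel, Complex.exp_zero,
        complexMulCLM_one]
    · rw [complexMulCLM_mul, ← Complex.exp_add, neg_add_cancel, Complex.exp_zero,
        complexMulCLM_one]

/-- The linear map `(x, y, z) ↦ (x, m y + n z, z)`. -/
noncomputable def shearCLM (m n : ℝ) : R3 →L[ℝ] R3 :=
  1 + (m - 1) • (EuclideanSpace.proj 1 : R3 →L[ℝ] ℝ).smulRight (EuclideanSpace.single 1 1)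
    + n • (EuclideanSpace.proj 2 : R3 →L[ℝ] ℝ).smulRight (EuclideanSpace.single 1 1)

theorem shearCLM_apply (m n : ℝ) (p : R3) :
    shearCLM m n p = !₂[p 0, m * p 1 + n * p 2, p 2] := by
  ext i
  fin_cases i <;> simp [shearCLM]
  ring

theorem shearCLM_mul (m n m' n' : ℝ) :
    shearCLM m n * shearCLM m' n' = shearCLM (m * m') (m * n' + n) := by
  ext p i
  fin_cases i <;> simp [shearCLM_apply]
  ring

theorem shearCLM_one_zero : shearCLM 1 0 = 1 := by
  ext p i
  fin_cases i <;> simp [shearCLM_apply]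

theorem shearCLM_rotR3 (m n : ℝ) (p : R3) : shearCLM m n (rotR3 p) = rotR3 (shearCLM m n p) := by
  ext i
  fin_cases i <;> simp [shearCLM_apply, rotR3]
  ring

theorem shearCLM_inv_mul {m : ℝ} (hm : m ≠ 0) (n : ℝ) :
    shearCLM m⁻¹ (-(m⁻¹ * n)) * shearCLM m n = 1 := by
  rw [shearCLM_mul, inv_mul_cancel₀ hm, add_neg_cancel, shearCLM_one_zero]

theorem shearCLM_mul_inv {m : ℝ} (hm : m ≠ 0) (n : ℝ) :
    shearCLM m n * shearCLM m⁻¹ (-(m⁻¹ * n)) = 1 := by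
  rw [shearCLM_mul, mul_inv_cancel₀ hm, mul_neg, mul_inv_cancel_left₀ hm, neg_add_cancel,
    shearCLM_one_zero]

/-- The linear path to the identity stays invertible because its diagonal entry is a convex
combination of `1` and `m > 0`. -/
theorem isRealizable_shearCLM {m : ℝ} (hm : 0 < m) (n : ℝ) : IsRealizable (shearCLM m n) := by
  have h := isRealizable_of_path (γ := fun s => shearCLM (1 + s * (m - 1)) (s * n))
    (by unfold shearCLM; fun_prop) (by simp [shearCLM_one_zero]) (fun s hs => ?_)
    (fun s p => shearCLM_rotR3 _ _ p)
  · simpa using h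
  · have hne : 1 + s * (m - 1) ≠ 0 := by
      rcases hs.1.eq_or_lt with rfl | h0
      · simp
      · nlinarith [mul_pos h0 hm, hs.2]
    exact ⟨⟨shearCLM (1 + s * (m - 1)) (s * n), _, shearCLM_mul_inv hne _, shearCLM_inv_mul hne _⟩,
      rfl⟩

end Linear

/-! ### Equivariant Darboux theorem in the normalized case -/

section Darboux

theorem eq_sum_single (v : R3) : v = v 0 • EuclideanSpace.single 0 1 +
    v 1 • EuclideanSpace.single 1 1 + v 2 • EuclideanSpace.single 2 1 := by
  ext i
  fin_cases i <;> simp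

theorem map_eq_sum_single (A : R3 →L[ℝ] ℝ) (v : R3) : A v =
    v 0 * A (EuclideanSpace.single 0 1) + v 1 * A (EuclideanSpace.single 1 1) +
      v 2 * A (EuclideanSpace.single 2 1) := by
  conv_lhs => rw [eq_sum_single v]
  simp only [map_add, map_smul, smul_eq_mul]

theorem stdForm_apply (p v : R3) : stdForm p v = v 2 - p 1 * v 0 := rfl

theorem rotR3_single_zero : rotR3 (EuclideanSpace.single 0 1) = EuclideanSpace.single 0 1 := by
  ext i
  fin_cases i <;> simp [rotR3]

theorem rotR3_single_one : rotR3 (EuclideanSpace.single 1 1) = -EuclideanSpace.single 1 1 := by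
  ext i
  fin_cases i <;> simp [rotR3]

theorem rotR3_single_two : rotR3 (EuclideanSpace.single 2 1) = -EuclideanSpace.single 2 1 := by
  ext i
  fin_cases i <;> simp [rotR3]

theorem rotR3_zero : rotR3 0 = 0 := by
  rw [← rotCLM_apply, map_zero]

theorem fderiv_comp_rotR3 {g : R3 → ℝ} (hg : Differentiable ℝ g) (p v : R3) :
    fderiv ℝ (fun p => g (rotR3 p)) p v = fderiv ℝ g (rotR3 p) (rotR3 v) := by
  have h : HasFDerivAt (fun p => g (rotCLM p)) ((fderiv ℝ g (rotCLM p)).comp rotCLM) p :=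
    (hg (rotCLM p)).hasFDerivAt.comp p rotCLM.hasFDerivAt
  simp only [rotCLM_apply] at h
  rw [h.fderiv, ContinuousLinearMap.comp_apply, rotCLM_apply]

theorem fderiv_rotR3_of_odd {g : R3 → ℝ} (hg : Differentiable ℝ g)
    (hu : ∀ p, g (rotR3 p) = -g p) (p v : R3) :
    fderiv ℝ g (rotR3 p) (rotR3 v) = -fderiv ℝ g p v := by
  rw [← fderiv_comp_rotR3 hg, funext hu, fderiv_fun_neg]
  rfl

/-- A smooth invariant function which is positive at the origin agrees near the origin with
a smooth invariant function which is positive everywhere. -/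
theorem exists_positive_extension {C : R3 → ℝ} (hC : ContDiff ℝ ∞ C)
    (hu : ∀ p, C (rotR3 p) = C p) (h0 : 0 < C 0) :
    ∃ C' : R3 → ℝ, ContDiff ℝ ∞ C' ∧ (∀ p, C' (rotR3 p) = C' p) ∧ (∀ p, 0 < C' p) ∧
      C' =ᶠ[𝓝 0] C := by
  obtain ⟨ε, hε, h⟩ := exists_pos_of_eventually_nhds_zero
    (hC.continuous.continuousAt.eventually (lt_mem_nhds h0))
  have hχ : ContDiff ℝ ∞ fun p : R3 => radialCutoff (ε⁻¹ • p) :=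
    contDiff_radialCutoff.comp (contDiff_const_smul ε⁻¹)
  refine ⟨fun p => radialCutoff (ε⁻¹ • p) * C p + (1 - radialCutoff (ε⁻¹ • p)),
    (hχ.mul hC).add (contDiff_const.sub hχ), fun p => ?_, fun p => ?_, ?_⟩
  · simp only [radialCutoff_smul_rotR3, hu]
  · beta_reduce
    by_cases hp : ‖p‖ < 3 * ε
    · have h1 := h p hp
      obtain ⟨h2, h3⟩ := radialCutoff_mem_Icc (ε⁻¹ • p)
      rcases h2.eq_or_lt with h4 | h4
      · rw [← h4]
        norm_num
      · have := mul_pos h4 h1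
        linarith
    · rw [radialCutoff_inv_smul_of_le_norm hε (by linarith)]
      norm_num
  · filter_upwards [radialCutoff_inv_smul_eventuallyEq hε] with p hp
    rw [hp]
    ring

/-- The odd part of any first integral will do: the involution reverses both `∂/∂y` and `∂/∂z` and
preserves `F`, so `g ∘ rotR3` solves the same equation. The reversal of `∂/∂z` also preserves the
normalization. -/
theorem exists_odd_first_integral {F : R3 → ℝ} (hF : ContDiff ℝ ∞ F)
    (hu : ∀ p, F (rotR3 p) = F p) :
    ∃ g : R3 → ℝ, ContDiff ℝ ∞ g ∧ (∀ p, g (rotR3 p) = -g p) ∧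
      fderiv ℝ g 0 (EuclideanSpace.single 2 1) = 1 ∧
      ∀ᶠ p in 𝓝 0, fderiv ℝ g p (EuclideanSpace.single 1 1) =
        F p * fderiv ℝ g p (EuclideanSpace.single 2 1) := by
  obtain ⟨g, hg, hz, hpde⟩ := exists_first_integral hF
  have hgd : Differentiable ℝ g := hg.differentiable (by simp)
  have hrot : ContDiff ℝ ∞ rotR3 := by
    have := rotCLM.contDiff (n := ∞)
    rwa [funext rotCLM_apply] at this
  have hgr : ContDiff ℝ ∞ fun p => g (rotR3 p) := hg.comp hrot
  have hd : ∀ p v, fderiv ℝ (fun p => (1 / 2 : ℝ) * (g p - g (rotR3 p))) p v =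
      1 / 2 * (fderiv ℝ g p v - fderiv ℝ g (rotR3 p) (rotR3 v)) := by
    intro p v
    have h : HasFDerivAt (fun p => (1 / 2 : ℝ) * (g p - g (rotR3 p))) _ p :=
      ((hgd p).hasFDerivAt.sub
        (hgr.differentiable (by simp) p).hasFDerivAt).const_mul (1 / 2 : ℝ)
    rw [h.fderiv, ← fderiv_comp_rotR3 hgd]
    rfl
  refine ⟨fun p => (1 / 2 : ℝ) * (g p - g (rotR3 p)), contDiff_const.mul (hg.sub hgr),
    fun p => ?_, ?_, ?_⟩
  · beta_reduce
    rw [rotR3_rotR3]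
    ring
  · rw [hd, rotR3_single_two, map_neg, rotR3_zero, hz]
    norm_num
  · have hr : Filter.Tendsto rotR3 (𝓝 0) (𝓝 0) :=
      hrot.continuous.tendsto' _ _ rotR3_zero
    filter_upwards [hpde, hr.eventually hpde] with p h1 h2
    rw [hd, hd, rotR3_single_two, rotR3_single_one, map_neg, map_neg, h1, h2, hu]
    ring

/-- Precomposing with the inverse shear makes the derivative at the origin exactly the identity; the
shear itself is then restored as a realizable linear map. -/
theorem isRealizable_of_fderiv_eq_shear {φ : R3 → R3} (hφ : ContDiff ℝ ∞ φ) (h0 : φ 0 = 0)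
    (hu : ∀ p, φ (rotR3 p) = rotR3 (φ p)) {m n : ℝ} (hm : 0 < m)
    (hd : fderiv ℝ φ 0 = shearCLM m n) : IsRealizable φ := by
  obtain ⟨c, hc, H⟩ := exists_pos_forall_isRealizable
  set S := shearCLM m⁻¹ (-(m⁻¹ * n)) with hS
  have h1 : IsRealizable (φ ∘ S) := by
    refine H _ (hφ.comp S.contDiff) (by simp [h0]) (fun p => ?_) ?_
    · simp only [Function.comp_apply, hS, shearCLM_rotR3, hu]
    · have h2 : HasFDerivAt φ (shearCLM m n) (S 0) := by
        rw [map_zero, ← hd]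
        exact (hφ.differentiable (by simp) 0).hasFDerivAt
      have h3 := (h2.comp (0 : R3) S.hasFDerivAt).fderiv
      have h4 : (shearCLM m n).comp S = ContinuousLinearMap.id ℝ R3 := shearCLM_mul_inv hm.ne' n
      rw [h3, h4, sub_self, norm_zero]
      exact hc
  refine (h1.comp (isRealizable_shearCLM hm n) (by fun_prop) (map_zero _)).congr
    (Filter.Eventually.of_forall fun p => ?_)
  rw [Function.comp_apply, Function.comp_apply, ← mul_apply_eq_comp, hS,
    shearCLM_inv_mul hm.ne']
  rfl

/-- Equivariant Darboux theorem for a form that is `dz` at the origin. -/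
theorem exists_darboux_of_normalized {a : R3 → R3 →L[ℝ] ℝ} (ha : IsPositiveContactR3 a)
    (hu : ∀ p v, a (rotR3 p) (rotR3 v) = -a p v)
    (hb0 : a 0 (EuclideanSpace.single 1 1) = 0) (hc0 : a 0 (EuclideanSpace.single 2 1) = 1) :
    ∃ φ : R3 → R3, IsRealizable φ ∧ ContDiff ℝ ∞ φ ∧ φ 0 = 0 ∧
      ∀ᶠ p in 𝓝 0, ∃ l : ℝ, l ≠ 0 ∧ ∀ v, stdForm (φ p) (fderiv ℝ φ p v) = l * a p v := by
  obtain ⟨has, hpos⟩ := ha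
  let e : Fin 3 → R3 := fun i => EuclideanSpace.single i 1
  have hcomp : ∀ i, ContDiff ℝ ∞ fun p => a p (e i) := fun i => has.clm_apply contDiff_const
  have hda : ∀ i p v, fderiv ℝ (fun p => a p (e i)) p v = fderiv ℝ a p v (e i) := by
    intro i p v
    rw [fderiv_clm_apply (has.differentiable (by simp) p) (differentiableAt_const _)]
    simp
  have hA : ∀ p, a (rotR3 p) (e 0) = -a p (e 0) := fun p => by
    rw [← hu, rotR3_single_zero]
  have hB : ∀ p, a (rotR3 p) (e 1) = a p (e 1) := fun p => by
    have := hu p (e 1)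
    rwa [rotR3_single_one, map_neg, neg_inj] at this
  have hC : ∀ p, a (rotR3 p) (e 2) = a p (e 2) := fun p => by
    have := hu p (e 2)
    rwa [rotR3_single_two, map_neg, neg_inj] at this
  have hA0 : a 0 (e 0) = 0 := by
    have := hA 0
    rw [rotR3_zero] at this
    linarith
  have hc0' : a 0 (e 2) = 1 := hc0
  have hb0' : a 0 (e 1) = 0 := hb0
  -- The `dz`-coefficient is replaced by a positive function with the same germ, so that division by
  -- it is smooth everywhere.
  obtain ⟨C, hCs, hCu, hCpos, hCa⟩ := exists_positive_extension (hcomp 2) hC (by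
    rw [hc0']
    exact one_pos)
  have hC0 : C 0 = 1 := hCa.self_of_nhds.trans hc0
  set F : R3 → ℝ := fun p => a p (e 1) * (C p)⁻¹ with hF
  have hCi : ContDiff ℝ ∞ fun p => (C p)⁻¹ := hCs.inv fun p => (hCpos p).ne'
  have hFs : ContDiff ℝ ∞ F := (hcomp 1).mul hCi
  have hF0 : F 0 = 0 := by simp [hF, hb0']
  obtain ⟨g, hg, hgu, hgz, hpde⟩ := exists_odd_first_integral hFs fun p => by
    simp only [hF, hB, hCu]
  have hgd : Differentiable ℝ g := hg.differentiable (by simp)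
  have hGs : ∀ i, ContDiff ℝ ∞ fun p => fderiv ℝ g p (e i) := fun i =>
    (hg.fderiv_right (by simp)).clm_apply contDiff_const
  have hgz' : fderiv ℝ g 0 (e 2) = 1 := hgz
  have hGz : ContDiff ℝ ∞ fun p => fderiv ℝ g p (e 2) * (C p)⁻¹ := (hGs 2).mul hCi
  -- The `dx`-coefficient of `dg` minus `(∂g/∂z)/C` times the form, the only component that survives
  -- near the origin.
  set f : R3 → ℝ := fun p => fderiv ℝ g p (e 0) -
    a p (e 0) * (fderiv ℝ g p (e 2) * (C p)⁻¹) with hf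
  have hfs : ContDiff ℝ ∞ f := (hGs 0).sub ((hcomp 0).mul hGz)
  have hfd : Differentiable ℝ f := hfs.differentiable (by simp)
  have hfu : ∀ p, f (rotR3 p) = -f p := by
    intro p
    have h0 := fderiv_rotR3_of_odd hgd hgu p (e 0)
    have h2 := fderiv_rotR3_of_odd hgd hgu p (e 2)
    rw [rotR3_single_zero] at h0
    rw [rotR3_single_two, map_neg, neg_inj] at h2
    have h0' : fderiv ℝ g (rotR3 p) (e 0) = -fderiv ℝ g p (e 0) := h0
    have h2' : fderiv ℝ g (rotR3 p) (e 2) = fderiv ℝ g p (e 2) := h2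
    simp only [hf, h0', h2', hA, hCu]
    ring
  have hodd0 : ∀ {k : R3 → ℝ}, (∀ p, k (rotR3 p) = -k p) → k 0 = 0 := by
    intro k hk
    have := hk 0
    rw [rotR3_zero] at this
    linarith
  -- The involution fixes the `x`-direction, so an odd function has zero `x`-derivative at the
  -- origin.
  have hodd1 : ∀ {k : R3 → ℝ}, Differentiable ℝ k → (∀ p, k (rotR3 p) = -k p) →
      fderiv ℝ k 0 (e 0) = 0 := by
    intro k hkd hk
    have := fderiv_rotR3_of_odd hkd hk 0 (e 0)
    rw [rotR3_zero, rotR3_single_zero] at this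
    have h' : fderiv ℝ k 0 (e 0) = -fderiv ℝ k 0 (e 0) := this
    linarith
  have hFd : fderiv ℝ F 0 (e 0) = fderiv ℝ a 0 (e 0) (e 1) := by
    have h : HasFDerivAt F _ 0 := ((hcomp 1).differentiable (by simp) 0).hasFDerivAt.mul
      (hCi.differentiable (by simp) 0).hasFDerivAt
    have h' := congrArg (fun L => L (e 0)) h.fderiv
    rw [← hda]
    simpa [hb0', hC0] using h'
  -- Exchanging the mixed partials of `g` leaves the `x`-derivative of `F ∂g/∂z`, where `F = 0` and
  -- `∂g/∂z = 1` at the origin.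
  have hsymm : fderiv ℝ (fun p => fderiv ℝ g p (e 0)) 0 (e 1) =
      fderiv ℝ a 0 (e 0) (e 1) := by
    have hd2 : ∀ i v, fderiv ℝ (fun p => fderiv ℝ g p (e i)) 0 v =
        fderiv ℝ (fderiv ℝ g) 0 v (e i) := by
      intro i v
      rw [fderiv_clm_apply ((hg.fderiv_right (m := ∞) (by simp)).differentiable (by simp) 0)
        (differentiableAt_const _)]
      simp
    have hs : IsSymmSndFDerivAt ℝ g 0 :=
      (contDiff_infty.1 hg 2).contDiffAt.isSymmSndFDerivAt (by simp)
    rw [hd2, hs.eq, ← hd2]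
    have heq : (fun p => fderiv ℝ g p (e 1)) =ᶠ[𝓝 0] fun p => F p * fderiv ℝ g p (e 2) := hpde
    rw [heq.fderiv_eq]
    have h : HasFDerivAt (fun p => F p * fderiv ℝ g p (e 2)) _ 0 := (hFs.differentiable (by simp) 0).hasFDerivAt.mul
      ((hGs 2).differentiable (by simp) 0).hasFDerivAt
    have h' := congrArg (fun L => L (e 0)) h.fderiv
    rw [← hFd]
    simpa [hF0, hgz'] using h'
  have hfy : fderiv ℝ f 0 (e 1) = fderiv ℝ a 0 (e 0) (e 1) - fderiv ℝ a 0 (e 1) (e 0) := by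
    have h : HasFDerivAt f _ 0 := ((hGs 0).differentiable (by simp) 0).hasFDerivAt.sub
      (((hcomp 0).differentiable (by simp) 0).hasFDerivAt.mul
        (hGz.differentiable (by simp) 0).hasFDerivAt)
    have h' := congrArg (fun L => L (e 1)) h.fderiv
    rw [← hsymm, ← hda 0 0 (e 1)]
    simpa [hA0, hgz', hC0] using h'
  -- At the origin the form is `dz`, so `a ∧ da` reduces to `da(e 0, e 1)`, which is `∂f/∂y`. This
  -- is where positivity of the contact form fixes the sign of the shear.
  have hm : 0 < fderiv ℝ f 0 (e 1) := by
    have := hpos 0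
    rw [hfy]
    change 0 < a 0 (e 0) * extDerivOne a 0 (e 1) (e 2) + a 0 (e 1) * extDerivOne a 0 (e 2) (e 0)
      + a 0 (e 2) * extDerivOne a 0 (e 0) (e 1) at this
    rw [hA0, hb0', hc0'] at this
    simpa [extDerivOne] using this
  have hgy : fderiv ℝ g 0 (e 1) = 0 := by
    have h := hpde.self_of_nhds
    rw [hF0, zero_mul] at h
    exact h
  set φ : R3 → R3 := fun p => p 0 • e 0 + f p • e 1 + g p • e 2 with hφ
  have hφa : ∀ p, φ p = !₂[p 0, f p, g p] := by
    intro p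
    ext i
    fin_cases i <;> simp [hφ, e]
  have hφs : ContDiff ℝ ∞ φ :=
    (((EuclideanSpace.proj 0 : R3 →L[ℝ] ℝ).contDiff.smul contDiff_const).add
      (hfs.smul contDiff_const)).add (hg.smul contDiff_const)
  have hφd : ∀ p v, fderiv ℝ φ p v = !₂[v 0, fderiv ℝ f p v, fderiv ℝ g p v] := by
    intro p v
    have h := (((EuclideanSpace.proj 0 : R3 →L[ℝ] ℝ).hasFDerivAt (x := p)).smul_const (e 0)).add
      ((hfd p).hasFDerivAt.smul_const (e 1)) |>.add ((hgd p).hasFDerivAt.smul_const (e 2))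
    have h' : HasFDerivAt φ _ p := h
    rw [h'.fderiv]
    ext i
    fin_cases i <;> simp [e]
  have hφ0 : φ 0 = 0 := by
    rw [hφa, hodd0 hfu, hodd0 hgu]
    ext i
    fin_cases i <;> simp
  refine ⟨φ, ?_, hφs, hφ0, ?_⟩
  · refine isRealizable_of_fderiv_eq_shear (m := fderiv ℝ f 0 (e 1)) (n := fderiv ℝ f 0 (e 2))
      hφs hφ0 (fun p => ?_) hm ?_
    · rw [hφa, hφa, hfu, hgu]
      ext i
      fin_cases i <;> simp [rotR3]
    · ext v i
      have h1 : fderiv ℝ f 0 v = v 0 * fderiv ℝ f 0 (e 0) + v 1 * fderiv ℝ f 0 (e 1) +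
        v 2 * fderiv ℝ f 0 (e 2) := map_eq_sum_single _ v
      have h2 : fderiv ℝ g 0 v = v 0 * fderiv ℝ g 0 (e 0) + v 1 * fderiv ℝ g 0 (e 1) +
        v 2 * fderiv ℝ g 0 (e 2) := map_eq_sum_single _ v
      rw [hodd1 hfd hfu] at h1
      rw [hodd1 hgd hgu, hgy, hgz'] at h2
      rw [hφd, shearCLM_apply, h1, h2]
      fin_cases i <;> simp
      ring
  · have hne : ∀ᶠ p in 𝓝 (0 : R3), fderiv ℝ g p (e 2) ≠ 0 :=
      (hGs 2).continuous.continuousAt.eventually (isOpen_ne.mem_nhds (by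
        simp [hgz']))
    filter_upwards [hne, hpde, hCa] with p h1 h2 h3
    have hCp := (hCpos p).ne'
    refine ⟨fderiv ℝ g p (e 2) * (C p)⁻¹, mul_ne_zero h1 (inv_ne_zero hCp), fun v => ?_⟩
    have e1 : fderiv ℝ g p v = v 0 * fderiv ℝ g p (e 0) + v 1 * fderiv ℝ g p (e 1) +
        v 2 * fderiv ℝ g p (e 2) := map_eq_sum_single _ v
    have e2 : a p v = v 0 * a p (e 0) + v 1 * a p (e 1) + v 2 * a p (e 2) :=
      map_eq_sum_single _ v
    have e3 : stdForm (φ p) (fderiv ℝ φ p v) = fderiv ℝ g p v - f p * v 0 := by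
      rw [hφd, hφa, stdForm_apply]
      simp
    have e4 : fderiv ℝ g p (e 1) = a p (e 1) * (C p)⁻¹ * fderiv ℝ g p (e 2) := h2
    have e5 : a p (e 2) = C p := h3.symm
    rw [e3, e1, e2, e4, e5, hf]
    field_simp
    ring

end Darboux

/-! ### Reduction to the normalized case, and transport of the plane field -/

section Darboux

theorem complexMulCLM_single_zero (w : ℂ) :
    complexMulCLM w (EuclideanSpace.single 0 1) = EuclideanSpace.single 0 1 := by
  ext i
  fin_cases i <;> simp [complexMulCLM_apply]

theorem complexMulCLM_single_one (w : ℂ) : complexMulCLM w (EuclideanSpace.single 1 1) =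
    w.re • EuclideanSpace.single 1 1 + w.im • EuclideanSpace.single 2 1 := by
  ext i
  fin_cases i <;> simp [complexMulCLM_apply]

theorem complexMulCLM_single_two (w : ℂ) : complexMulCLM w (EuclideanSpace.single 2 1) =
    (-w.im) • EuclideanSpace.single 1 1 + w.re • EuclideanSpace.single 2 1 := by
  ext i
  fin_cases i <;> simp [complexMulCLM_apply]

theorem extDerivOne_comp_linear {a : R3 → R3 →L[ℝ] ℝ} (ha : ContDiff ℝ ∞ a)
    (Q : R3 →L[ℝ] R3) (p v w : R3) :
    extDerivOne (fun p => (a (Q p)).comp Q) p v w = extDerivOne a (Q p) (Q v) (Q w) := by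
  have h : HasFDerivAt (fun p => a (Q p)) ((fderiv ℝ a (Q p)).comp Q) p :=
    ((ha.differentiable (by simp)) (Q p)).hasFDerivAt.comp p Q.hasFDerivAt
  have h2 := h.clm_comp (hasFDerivAt_const Q p)
  rw [extDerivOne, h2.fderiv, extDerivOne]
  simp

/-- The factor is the determinant `|w|²` of the linear map, so nonzero complex multiplications
preserve positivity. -/
theorem wedgeExtDeriv_comp_complexMulCLM {a : R3 → R3 →L[ℝ] ℝ} (ha : ContDiff ℝ ∞ a) (w : ℂ)
    (p : R3) : wedgeExtDeriv (fun p => (a (complexMulCLM w p)).comp (complexMulCLM w)) p =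
      (w.re ^ 2 + w.im ^ 2) * wedgeExtDeriv a (complexMulCLM w p) := by
  simp only [wedgeExtDeriv, extDerivOne_comp_linear ha, ContinuousLinearMap.comp_apply,
    complexMulCLM_single_zero, complexMulCLM_single_one, complexMulCLM_single_two]
  simp only [extDerivOne, map_add, map_smul, add_apply, smul_apply, smul_eq_mul]
  ring

/-- Local equivariant Darboux theorem. -/
theorem exists_darboux {a : R3 → R3 →L[ℝ] ℝ} (ha : IsPositiveContactR3 a)
    (hu : ∀ p v, a (rotR3 p) (rotR3 v) = -a p v) :
    ∃ φ : R3 → R3, IsRealizable φ ∧ ContDiff ℝ ∞ φ ∧ φ 0 = 0 ∧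
      ∀ᶠ p in 𝓝 0, ∃ l : ℝ, l ≠ 0 ∧ ∀ v, stdForm (φ p) (fderiv ℝ φ p v) = l * a p v := by
  set B : ℝ := a 0 (EuclideanSpace.single 1 1) with hB
  set C : ℝ := a 0 (EuclideanSpace.single 2 1) with hC
  have hA : a 0 (EuclideanSpace.single 0 1) = 0 := by
    have := hu 0 (EuclideanSpace.single 0 1)
    rw [rotR3_zero, rotR3_single_zero] at this
    linarith
  -- Pulling `B dy + C dz` back by multiplication by `1 / (C + iB)` gives `dz`; the contact
  -- condition forces `C + iB ≠ 0`.
  set β : ℂ := ⟨C, B⟩ with hβ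
  have hβ0 : β ≠ 0 := by
    intro h
    have hC0 : C = 0 := congrArg Complex.re h
    have hB0 : B = 0 := congrArg Complex.im h
    have := ha.2 0
    simp only [wedgeExtDeriv, hA, ← hB, ← hC, hB0, hC0] at this
    simp at this
  have hns : C ^ 2 + B ^ 2 ≠ 0 := by
    have := (Complex.normSq_pos.2 hβ0).ne'
    rw [Complex.normSq_apply] at this
    intro h
    exact this (by rw [← h, hβ]; ring)
  have hre : (β⁻¹).re = C / (C ^ 2 + B ^ 2) := by
    rw [Complex.inv_re, Complex.normSq_apply, hβ]
    ring
  have him : (β⁻¹).im = -B / (C ^ 2 + B ^ 2) := by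
    rw [Complex.inv_im, Complex.normSq_apply, hβ]
    ring
  set Q := complexMulCLM β⁻¹ with hQ
  have hQβ : ∀ p, Q (complexMulCLM β p) = p := fun p => by
    rw [← mul_apply_eq_comp, complexMulCLM_mul, inv_mul_cancel₀ hβ0, complexMulCLM_one]
    rfl
  have ha' : IsPositiveContactR3 fun p => (a (Q p)).comp Q := by
    refine ⟨(ha.1.comp Q.contDiff).clm_comp contDiff_const, fun p => ?_⟩
    rw [hQ, wedgeExtDeriv_comp_complexMulCLM ha.1]
    refine mul_pos ?_ (ha.2 _)
    have := Complex.normSq_pos.2 (inv_ne_zero hβ0)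
    rw [Complex.normSq_apply] at this
    nlinarith
  obtain ⟨φ, hr, hs, h0, hφ⟩ := exists_darboux_of_normalized ha'
    (fun p v => by simp only [ContinuousLinearMap.comp_apply, hQ, complexMulCLM_rotR3, hu])
    (by
      rw [ContinuousLinearMap.comp_apply, map_zero, hQ, complexMulCLM_single_one, map_add,
        map_smul, map_smul, ← hB, ← hC, hre, him, smul_eq_mul, smul_eq_mul]
      ring)
    (by
      rw [ContinuousLinearMap.comp_apply, map_zero, hQ, complexMulCLM_single_two, map_add,
        map_smul, map_smul, ← hB, ← hC, hre, him, smul_eq_mul, smul_eq_mul]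
      field_simp
      ring)
  refine ⟨φ ∘ complexMulCLM β, hr.comp (isRealizable_complexMulCLM hβ0) (by fun_prop)
    (map_zero _), hs.comp (complexMulCLM β).contDiff, by simp [h0], ?_⟩
  have hc : Filter.Tendsto (complexMulCLM β) (𝓝 0) (𝓝 0) :=
    (complexMulCLM β).continuous.tendsto' _ _ (map_zero _)
  filter_upwards [hc.eventually hφ] with p ⟨l, hl, h⟩
  refine ⟨l, hl, fun v => ?_⟩
  have hd : HasFDerivAt (φ ∘ complexMulCLM β)
      ((fderiv ℝ φ (complexMulCLM β p)).comp (complexMulCLM β)) p :=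
    ((hs.differentiable (by simp)) _).hasFDerivAt.comp p (complexMulCLM β).hasFDerivAt
  rw [hd.fderiv, ContinuousLinearMap.comp_apply, Function.comp_apply, h,
    ContinuousLinearMap.comp_apply, hQβ, hQβ]

/-- Proportional forms have the same kernel. As `ψ` has the germ of `φ`, evaluating the
proportionality at `ψ.symm q` on the image of `v` under the derivative of `ψ.symm` compares the two
planes at `q`. -/
theorem eventually_pushforward_ker_eq {a : OneForm R3} {φ : R3 → R3} (h0 : φ 0 = 0)
    (hφ : ∀ᶠ p in 𝓝 0, ∃ l : ℝ, l ≠ 0 ∧ ∀ v : R3, stdForm (φ p) (fderiv ℝ φ p v) = l * a p v)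
    (ψ : R3 ≃ₘ^∞⟮𝓡 3, 𝓡 3⟯ R3) (hψ : ∀ᶠ p in 𝓝 (0 : R3), ψ p = φ p) :
    ∀ᶠ p in 𝓝 (0 : R3), TangentField.pushforward ψ (OneForm.ker a) p =
      OneForm.ker stdForm p := by
  have hψ0 : ψ.symm 0 = 0 := by
    have h1 : ψ 0 = 0 := hψ.self_of_nhds.trans h0
    rw [← h1, ψ.symm_apply_apply, h1]
  have hc : Filter.Tendsto ψ.symm (𝓝 0) (𝓝 0) := ψ.symm.continuous.tendsto' _ _ hψ0
  have hd : Differentiable ℝ ψ := (ψ.contMDiff.contDiff).differentiable (by simp)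
  have hds : Differentiable ℝ ψ.symm := (ψ.symm.contMDiff.contDiff).differentiable (by simp)
  filter_upwards [hc.eventually hφ, hc.eventually hψ.eventually_nhds] with q ⟨l, hl, h⟩ hq
  have hfd : fderiv ℝ ψ (ψ.symm q) = fderiv ℝ φ (ψ.symm q) := Filter.EventuallyEq.fderiv_eq hq
  have hval : φ (ψ.symm q) = q := by
    rw [← hq.self_of_nhds, ψ.apply_symm_apply]
  have hchain : ∀ v : R3, fderiv ℝ φ (ψ.symm q) (fderiv ℝ ψ.symm q v) = v := by
    intro v
    have h1 : HasFDerivAt (ψ ∘ ψ.symm) ((fderiv ℝ ψ (ψ.symm q)).comp (fderiv ℝ ψ.symm q)) q :=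
      (hd _).hasFDerivAt.comp q (hds q).hasFDerivAt
    have h2 : ψ ∘ ψ.symm = id := funext ψ.apply_symm_apply
    rw [h2] at h1
    have h3 := congrArg (fun L => L v) (h1.unique (hasFDerivAt_id q))
    rw [← hfd]
    exact h3
  refine Submodule.ext fun v => ?_
  have e1 : stdForm q v = l * a (ψ.symm q) (fderiv ℝ ψ.symm q v) := by
    rw [← h, hval]
    exact congrArg (stdForm q) (hchain v).symm
  have e2 : v ∈ OneForm.ker stdForm q ↔ stdForm q v = 0 := Iff.rfl
  have e3 : v ∈ TangentField.pushforward ψ (OneForm.ker a) q ↔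
      a (ψ.symm q) (mfderiv (𝓡 3) (𝓡 3) ψ.symm q v) = 0 := Iff.rfl
  rw [e2, e3, e1, mfderiv_eq_fderiv]
  exact ⟨fun h => mul_eq_zero_of_right _ h, fun h => (mul_eq_zero.1 h).resolve_left hl⟩

end Darboux

/-! ### Functoriality of pull-backs -/

section Pullback

variable {M N N' : Type*} [TopologicalSpace M] [ChartedSpace R3 M]
  [TopologicalSpace N] [ChartedSpace R3 N] [TopologicalSpace N'] [ChartedSpace R3 N']

theorem OneForm.pullback_pullback {f : M → N} {g : N → N'} (hg : MDifferentiable (𝓡 3) (𝓡 3) g)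
    (hf : MDifferentiable (𝓡 3) (𝓡 3) f) (α : OneForm N') :
    OneForm.pullback f (OneForm.pullback g α) = OneForm.pullback (g ∘ f) α := by
  funext p
  unfold OneForm.pullback
  rw [mfderiv_comp p (hg (f p)) (hf p)]
  rfl

theorem TangentField.pullback_pullback {f : M → N} {g : N → N'}
    (hg : MDifferentiable (𝓡 3) (𝓡 3) g) (hf : MDifferentiable (𝓡 3) (𝓡 3) f)
    (ξ : TangentField N') :
    TangentField.pullback f (TangentField.pullback g ξ) = TangentField.pullback (g ∘ f) ξ := by
  funext p
  unfold TangentField.pullback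
  rw [mfderiv_comp p (hg (f p)) (hf p)]
  rfl

theorem OneForm.ker_pullback (f : M → N) (α : OneForm N) :
    OneForm.ker (OneForm.pullback f α) = TangentField.pullback f (OneForm.ker α) := rfl

end Pullback

/-! ### Stereographic projection and extension to the sphere -/

section Sphere

theorem contMDiff_coe_S3 :
    ContMDiff (𝓡 3) 𝓘(ℝ, EuclideanSpace ℝ (Fin 4)) ∞ (Subtype.val : S3 → _) :=
  haveI : Fact (Module.finrank ℝ (EuclideanSpace ℝ (Fin 4)) = 3 + 1) :=
    ⟨finrank_euclideanSpace_fin⟩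
  contMDiff_coe_sphere

theorem contMDiff_S3_of_coe {M : Type*} [TopologicalSpace M] [ChartedSpace R3 M]
    [IsManifold (𝓡 3) ∞ M] {f : M → S3}
    (hf : ContMDiff (𝓡 3) 𝓘(ℝ, EuclideanSpace ℝ (Fin 4)) ∞ fun p => (f p).1) :
    ContMDiff (𝓡 3) (𝓡 3) ∞ f :=
  haveI : Fact (Module.finrank ℝ (EuclideanSpace ℝ (Fin 4)) = 3 + 1) :=
    ⟨finrank_euclideanSpace_fin⟩
  hf.codRestrict_sphere fun p => (f p).2

theorem contMDiff_stereoInv : ContMDiff (𝓡 3) (𝓡 3) ∞ stereoInv := by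
  have h : ContMDiff (𝓡 3) 𝓘(ℝ, EuclideanSpace ℝ (Fin 4)) ∞ fun p : R3 => (stereoInv p).1 := by
    rw [contMDiff_iff_contDiff, contDiff_euclidean]
    have hc : ∀ i : Fin 3, ContDiff ℝ ∞ fun p : R3 => p i := fun i => by fun_prop
    have hd : ContDiff ℝ ∞ fun p : R3 => p 0 ^ 2 + p 1 ^ 2 + p 2 ^ 2 + 1 := by fun_prop
    have hn : ∀ p : R3, p 0 ^ 2 + p 1 ^ 2 + p 2 ^ 2 + 1 ≠ 0 := fun p => by positivity
    intro i
    fin_cases i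
    · exact (contDiff_const.mul (hc 0)).div hd hn
    · exact (contDiff_const.mul (hc 1)).div hd hn
    · exact (contDiff_const.mul (hc 2)).div hd hn
    · exact ((((hc 0).pow 2).add ((hc 1).pow 2)).add ((hc 2).pow 2) |>.sub contDiff_const).div hd hn
  exact contMDiff_S3_of_coe h

theorem contMDiff_rotS3 : ContMDiff (𝓡 3) (𝓡 3) ∞ rotS3 := by
  have hl : ContDiff ℝ ∞ fun x : EuclideanSpace ℝ (Fin 4) =>
      (!₂[x 0, -x 1, -x 2, x 3] : EuclideanSpace ℝ (Fin 4)) := by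
    rw [contDiff_euclidean]
    have hc : ∀ i : Fin 4, ContDiff ℝ ∞ fun x : EuclideanSpace ℝ (Fin 4) => x i :=
      fun i => by fun_prop
    intro i
    fin_cases i
    · exact hc 0
    · exact (hc 1).neg
    · exact (hc 2).neg
    · exact hc 3
  have h : ContMDiff (𝓡 3) 𝓘(ℝ, EuclideanSpace ℝ (Fin 4)) ∞ fun q : S3 => (rotS3 q).1 :=
    hl.contMDiff.comp contMDiff_coe_S3
  exact contMDiff_S3_of_coe h

/-- Stereographic projection from `∞ = (0, 0, 0, 1)`. -/
noncomputable def stereoProj (q : S3) : R3 :=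
  !₂[q.1 0 / (1 - q.1 3), q.1 1 / (1 - q.1 3), q.1 2 / (1 - q.1 3)]

theorem stereoProj_stereoInv (p : R3) : stereoProj (stereoInv p) = p := by
  have h : p 0 ^ 2 + p 1 ^ 2 + p 2 ^ 2 + 1 ≠ 0 := by positivity
  have h2 : 1 - (p 0 ^ 2 + p 1 ^ 2 + p 2 ^ 2 - 1) / (p 0 ^ 2 + p 1 ^ 2 + p 2 ^ 2 + 1) =
      2 / (p 0 ^ 2 + p 1 ^ 2 + p 2 ^ 2 + 1) := by
    field_simp
    ring
  ext i
  fin_cases i <;> simp [stereoProj, stereoInv, h2] <;> field_simp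

theorem stereoInv_three_ne (p : R3) : (stereoInv p).1 3 ≠ 1 := by
  have h : p 0 ^ 2 + p 1 ^ 2 + p 2 ^ 2 + 1 ≠ 0 := by positivity
  intro h1
  have h2 : (p 0 ^ 2 + p 1 ^ 2 + p 2 ^ 2 - 1) / (p 0 ^ 2 + p 1 ^ 2 + p 2 ^ 2 + 1) = 1 := h1
  rw [div_eq_one_iff_eq h] at h2
  linarith

theorem stereoInv_stereoProj {q : S3} (hq : q.1 3 ≠ 1) : stereoInv (stereoProj q) = q := by
  have h := (mem_S3_iff q.1).1 q.2
  have h1 : 1 - q.1 3 ≠ 0 := sub_ne_zero.2 hq.symm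
  have hs : (q.1 0 / (1 - q.1 3)) ^ 2 + (q.1 1 / (1 - q.1 3)) ^ 2 + (q.1 2 / (1 - q.1 3)) ^ 2 =
      (1 + q.1 3) / (1 - q.1 3) := by
    field_simp
    linear_combination h
  have hs2 : (1 + q.1 3) / (1 - q.1 3) + 1 = 2 / (1 - q.1 3) := by
    field_simp
    ring
  refine Subtype.ext ?_
  ext i
  fin_cases i <;> simp [stereoProj, stereoInv, hs, hs2] <;> field_simp
  ring

theorem norm_stereoProj_sq {q : S3} (hq : q.1 3 ≠ 1) :
    ‖stereoProj q‖ ^ 2 = (1 + q.1 3) / (1 - q.1 3) := by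
  have h := (mem_S3_iff q.1).1 q.2
  have h1 : 1 - q.1 3 ≠ 0 := sub_ne_zero.2 hq.symm
  rw [EuclideanSpace.norm_sq_eq, Fin.sum_univ_three]
  simp only [stereoProj, Real.norm_eq_abs, sq_abs]
  simp
  field_simp
  linear_combination h

theorem contMDiffAt_stereoProj {q : S3} (hq : q.1 3 ≠ 1) :
    ContMDiffAt (𝓡 3) (𝓡 3) ∞ stereoProj q := by
  have h1 : 1 - q.1 3 ≠ 0 := sub_ne_zero.2 hq.symm
  have h : ContDiffAt ℝ ∞ (fun x : EuclideanSpace ℝ (Fin 4) =>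
      (!₂[x 0 / (1 - x 3), x 1 / (1 - x 3), x 2 / (1 - x 3)] : R3)) q.1 := by
    rw [contDiffAt_euclidean]
    have hc : ∀ i : Fin 4, ContDiffAt ℝ ∞ (fun x : EuclideanSpace ℝ (Fin 4) => x i) q.1 :=
      fun i => by fun_prop
    intro i
    fin_cases i
    · exact (hc 0).div (contDiffAt_const.sub (hc 3)) h1
    · exact (hc 1).div (contDiffAt_const.sub (hc 3)) h1
    · exact (hc 2).div (contDiffAt_const.sub (hc 3)) h1
  exact h.contMDiffAt.comp q contMDiff_coe_S3.contMDiffAt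

theorem stereoInv_rotR3 (p : R3) : stereoInv (rotR3 p) = rotS3 (stereoInv p) := by
  refine Subtype.ext ?_
  ext i
  fin_cases i <;> simp [stereoInv, rotS3, rotR3] <;> ring

theorem stereoProj_rotS3 (q : S3) : stereoProj (rotS3 q) = rotR3 (stereoProj q) := by
  ext i
  fin_cases i <;> simp [stereoProj, rotS3, rotR3] <;> ring

open Classical in
/-- The extension of a self-map of `ℝ³` to `S³ = ℝ³ ∪ {∞}` fixing `∞`. -/
noncomputable def sphereExtend (f : R3 → R3) (q : S3) : S3 :=
  if q.1 3 = 1 then q else stereoInv (f (stereoProj q))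

theorem sphereExtend_of_ne (f : R3 → R3) {q : S3} (hq : q.1 3 ≠ 1) :
    sphereExtend f q = stereoInv (f (stereoProj q)) := if_neg hq

theorem sphereExtend_of_eq (f : R3 → R3) {q : S3} (hq : q.1 3 = 1) : sphereExtend f q = q :=
  if_pos hq

theorem sphereExtend_stereoInv (f : R3 → R3) (p : R3) :
    sphereExtend f (stereoInv p) = stereoInv (f p) := by
  rw [sphereExtend_of_ne f (stereoInv_three_ne p), stereoProj_stereoInv]

theorem sphereExtend_eq_self {f : R3 → R3} {q : S3} (h : f (stereoProj q) = stereoProj q) :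
    sphereExtend f q = q := by
  by_cases hq : q.1 3 = 1
  · exact sphereExtend_of_eq f hq
  · rw [sphereExtend_of_ne f hq, h, stereoInv_stereoProj hq]

theorem sphereExtend_leftInverse {f g : R3 → R3} (h : Function.LeftInverse f g) :
    Function.LeftInverse (sphereExtend f) (sphereExtend g) := by
  intro q
  by_cases hq : q.1 3 = 1
  · rw [sphereExtend_of_eq g hq, sphereExtend_of_eq f hq]
  · rw [sphereExtend_of_ne g hq, sphereExtend_stereoInv, h, stereoInv_stereoProj hq]

theorem sphereExtend_rotS3 {f : R3 → R3} (h : ∀ p, f (rotR3 p) = rotR3 (f p)) (q : S3) :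
    sphereExtend f (rotS3 q) = rotS3 (sphereExtend f q) := by
  have h3 : (rotS3 q).1 3 = q.1 3 := by simp [rotS3]
  by_cases hq : q.1 3 = 1
  · rw [sphereExtend_of_eq f hq, sphereExtend_of_eq f (h3.trans hq)]
  · rw [sphereExtend_of_ne f hq, sphereExtend_of_ne f (by rwa [h3]), stereoProj_rotS3, h,
      stereoInv_rotR3]

/-- Near `∞` the extension is the identity, uniformly in the parameter because `R` does not depend
on it; elsewhere it is the given family read through stereographic projection. -/
theorem contMDiffOn_sphereExtend {f : ℝ → R3 → R3} {s : Set ℝ}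
    (hf : ContMDiffOn (𝓘(ℝ, ℝ).prod (𝓡 3)) (𝓡 3) ∞ (fun q : ℝ × R3 => f q.1 q.2)
      (s ×ˢ Set.univ)) {R : ℝ} (hR : ∀ t p, R ≤ ‖p‖ → f t p = p) :
    ContMDiffOn (𝓘(ℝ, ℝ).prod (𝓡 3)) (𝓡 3) ∞ (fun q : ℝ × S3 => sphereExtend (f q.1) q.2)
      (s ×ˢ Set.univ) := by
  have hc : Continuous fun q : ℝ × S3 => q.2.1 3 := by fun_prop
  rintro ⟨t, q⟩ ht
  by_cases hq : q.1 3 = 1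
  -- The squared norm of the projection is `2 / (1 - x₃) - 1`, which exceeds `R ^ 2` once `1 - x₃ <
  -- 1 / (1 + R ^ 2)`.
  · have h1 : ∀ᶠ x : ℝ × S3 in 𝓝 (t, q), 1 - 1 / (1 + R ^ 2) < x.2.1 3 :=
      hc.continuousAt.eventually (lt_mem_nhds (by
        have : 0 < 1 / (1 + R ^ 2) := by positivity
        linarith))
    refine (contMDiffWithinAt_snd (n := ∞)).congr_of_eventuallyEq
      (Filter.Eventually.filter_mono nhdsWithin_le_nhds ?_) (sphereExtend_of_eq _ hq)
    filter_upwards [h1] with x hx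
    by_cases hx1 : x.2.1 3 = 1
    · exact sphereExtend_of_eq _ hx1
    · refine sphereExtend_eq_self (hR _ _ (abs_le_of_sq_le_sq' ?_ (norm_nonneg _)).2)
      rw [norm_stereoProj_sq hx1]
      have hsq := (mem_S3_iff x.2.1).1 x.2.2
      have hle : x.2.1 3 ≤ 1 := by
        nlinarith [sq_nonneg (x.2.1 0), sq_nonneg (x.2.1 1), sq_nonneg (x.2.1 2)]
      have hlt : 0 < 1 - x.2.1 3 := by
        have := lt_of_le_of_ne hle hx1
        linarith
      rw [le_div_iff₀ hlt]
      have h2 : 1 - x.2.1 3 < 1 / (1 + R ^ 2) := by linarith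
      rw [lt_div_iff₀ (by positivity)] at h2
      nlinarith [sq_nonneg R, mul_nonneg (sq_nonneg R) hlt.le]
  · have h1 : ∀ᶠ x : ℝ × S3 in 𝓝 (t, q), x.2.1 3 ≠ 1 :=
      hc.continuousAt.eventually_ne hq
    have hτ : ContMDiffAt (𝓡 3) (𝓡 3) ∞ stereoProj (t, q).2 := contMDiffAt_stereoProj hq
    have h2 : ContMDiffAt (𝓘(ℝ, ℝ).prod (𝓡 3)) (𝓘(ℝ, ℝ).prod (𝓡 3)) ∞
        (fun x : ℝ × S3 => (x.1, stereoProj x.2)) (t, q) :=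
      contMDiffAt_fst.prodMk (hτ.comp (t, q) contMDiffAt_snd)
    have h3 : ContMDiffWithinAt (𝓘(ℝ, ℝ).prod (𝓡 3)) (𝓡 3) ∞
        (fun x : ℝ × S3 => f x.1 (stereoProj x.2)) (s ×ˢ Set.univ) (t, q) :=
      ContMDiffWithinAt.comp (t, q) (hf (t, stereoProj q) (Set.mk_mem_prod ht.1 (Set.mem_univ _)))
        h2.contMDiffWithinAt
        fun x hx => Set.mk_mem_prod hx.1 (Set.mem_univ _)
    refine (contMDiff_stereoInv.contMDiffAt.comp_contMDiffWithinAt (t, q) h3).congr_of_eventuallyEq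
      (Filter.Eventually.filter_mono nhdsWithin_le_nhds ?_) (sphereExtend_of_ne _ hq)
    filter_upwards [h1] with x hx using sphereExtend_of_ne _ hx

theorem contMDiff_sphereExtend {f : R3 → R3} (hf : ContMDiff (𝓡 3) (𝓡 3) ∞ f) {R : ℝ}
    (hR : ∀ p, R ≤ ‖p‖ → f p = p) : ContMDiff (𝓡 3) (𝓡 3) ∞ (sphereExtend f) := by
  have h := contMDiffOn_sphereExtend (f := fun _ => f) (s := Set.univ)
    (hf.comp contMDiff_snd).contMDiffOn fun _ => hR
  rw [Set.univ_prod_univ, contMDiffOn_univ] at h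
  exact h.comp ((contMDiff_const (c := (0 : ℝ))).prodMk contMDiff_id)

/-- The extension of a compactly supported diffeomorphism of `ℝ³` to `S³`. -/
noncomputable def sphereDiffeomorph (ψ : R3 ≃ₘ^∞⟮𝓡 3, 𝓡 3⟯ R3) {R : ℝ}
    (hR : ∀ p, R ≤ ‖p‖ → ψ p = p) : S3 ≃ₘ^∞⟮𝓡 3, 𝓡 3⟯ S3 where
  toFun := sphereExtend ψ
  invFun := sphereExtend ψ.symm
  left_inv := sphereExtend_leftInverse ψ.symm_apply_apply
  right_inv := sphereExtend_leftInverse ψ.apply_symm_apply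
  contMDiff_toFun := contMDiff_sphereExtend ψ.contMDiff hR
  contMDiff_invFun := contMDiff_sphereExtend ψ.symm.contMDiff fun p hp => by
    conv_lhs => rw [← hR p hp]
    exact ψ.symm_apply_apply p

end Sphere

/-! ### Conclusion for `ℝ³` and for the sphere -/

theorem mdifferentiable_rotR3 : MDifferentiable (𝓡 3) (𝓡 3) rotR3 := by
  rw [← funext rotCLM_apply]
  exact rotCLM.differentiable.mdifferentiable

theorem pullback_rotR3_apply (a : OneForm R3) (p v : R3) :
    OneForm.pullback rotR3 a p v = a (rotR3 p) (rotR3 v) := by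
  have h : mfderiv (𝓡 3) (𝓡 3) rotR3 p = rotCLM := by
    rw [mfderiv_eq_fderiv, ← funext rotCLM_apply, rotCLM.fderiv]
  change a (rotR3 p) (mfderiv (𝓡 3) (𝓡 3) rotR3 p v) = _
  rw [h]
  exact congrArg (a (rotR3 p)) (rotCLM_apply v)

theorem proposition2p5 :
    (∀ ξ : TangentField R3, IsInvariantContactStructure atlasR3 rotR3 ξ →
      ∃ ψ : ℝ → R3 ≃ₘ^∞⟮𝓡 3, 𝓡 3⟯ R3, IsEquivariantIsotopy rotR3 ψ ∧
        ∀ᶠ p in 𝓝 (0 : R3), TangentField.pushforward (ψ 1) ξ p = OneForm.ker stdForm p) ∧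
    (∀ ξ : TangentField S3, IsInvariantContactStructure atlasS3 rotS3 ξ →
      ∃ ψ : ℝ → S3 ≃ₘ^∞⟮𝓡 3, 𝓡 3⟯ S3, IsEquivariantIsotopy rotS3 ψ ∧
        ∀ᶠ p in 𝓝 (0 : R3),
          TangentField.pullback stereoInv (TangentField.pushforward (ψ 1) ξ) p =
            OneForm.ker stdForm p) := by
  constructor
  · rintro ξ ⟨-, α, hα, rfl, hu⟩
    have hid : OneForm.pullback id α = α := by
      funext p
      unfold OneForm.pullback
      rw [mfderiv_id]
      rfl
    have ha : IsPositiveContactR3 α := by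
      have := hα id rfl
      rwa [hid] at this
    obtain ⟨φ, ⟨ψ, h1, -, h3⟩, -, h0, hφ⟩ := exists_darboux ha fun p v =>
      (pullback_rotR3_apply α p v).symm.trans (congrArg (fun L : R3 →L[ℝ] ℝ => L v) (hu p))
    exact ⟨ψ, h1, eventually_pushforward_ker_eq h0 hφ (ψ 1) h3⟩
  · rintro ξ ⟨-, α, hα, rfl, hu⟩
    have hσ := contMDiff_stereoInv.mdifferentiable (by simp)
    -- `stereoInv` intertwines the two involutions, so anti-invariance passes to the form on `ℝ³`.
    have hrot : OneForm.pullback rotR3 (OneForm.pullback stereoInv α) =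
        OneForm.pullback stereoInv (OneForm.pullback rotS3 α) := by
      rw [OneForm.pullback_pullback hσ mdifferentiable_rotR3,
        OneForm.pullback_pullback (contMDiff_rotS3.mdifferentiable (by simp)) hσ]
      congr 1
      exact funext stereoInv_rotR3
    have hanti : ∀ p, OneForm.pullback rotR3 (OneForm.pullback stereoInv α) p =
        -OneForm.pullback stereoInv α p := fun p => by
      rw [hrot, OneForm.pullback, hu]
      rfl
    obtain ⟨φ, ⟨ψ, h1, ⟨R, hR⟩, h3⟩, -, h0, hφ⟩ :=
      exists_darboux (a := OneForm.pullback stereoInv α) (hα _ (Or.inl rfl)) fun p v =>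
        (pullback_rotR3_apply _ p v).symm.trans
          (congrArg (fun L : R3 →L[ℝ] ℝ => L v) (hanti p))
    refine ⟨fun t => sphereDiffeomorph (ψ t) (hR t), ⟨?_, ?_, ?_⟩, ?_⟩
    · exact contMDiffOn_sphereExtend (f := fun t => ψ t) h1.smooth hR
    · exact fun q => sphereExtend_eq_self (h1.zero _)
    · exact fun t ht q => sphereExtend_rotS3 (h1.equivariant t ht) q
    · filter_upwards [eventually_pushforward_ker_eq h0 hφ (ψ 1) h3] with p hp
      -- Both sides become pull-backs of the same kernel field, along `sphereExtend (ψ 1).symm ∘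
      -- stereoInv` and `stereoInv ∘ (ψ 1).symm`, which are the same map.
      rw [← hp, TangentField.pushforward, TangentField.pushforward, OneForm.ker_pullback,
        TangentField.pullback_pullback
          ((sphereDiffeomorph (ψ 1) (hR 1)).symm.contMDiff.mdifferentiable (by simp)) hσ,
        TangentField.pullback_pullback hσ ((ψ 1).symm.contMDiff.mdifferentiable (by simp))]
      congr 1
      exact funext (sphereExtend_stereoInv (ψ 1).symm)
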